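/- For a positive integer $m$ write $\mathbb{Z}_m=\mathbb{Z}/m\mathbb{Z}$. For a commutative unital ring $R$ let $\mathrm{Sp}(2n,R)$ be the group of all $x\in\mathrm{GL}(2n,R)$ with $xJx^{\top}=J$, where $J=\begin{pmatrix}0&1_n\\-1_n&0\end{pmatrix}$. If $N$ is a normal subgroup of a group $G$, a proper supplement of $N$ in $G$ is a proper subgroup $S<G$ with $NS=G$. **Theorem.** Let $p$ be a prime, let $a\ge 2$ and $n\ge 2$ be integers, and let $G=\mathrm{SL}(n,\mathbb{Z}_{p^a})$ or $G=\mathrm{Sp}(2n,\mathbb{Z}_{p^a})$. Let $K_{p^{a-1}}$ be the kernel of entrywise reduction modulo $p^{a-1}$ on $G$. Then $K_{p^{a-1}}$ has a proper supplement in $G$ if and only if $G$ is one of $$\mathrm{SL}(2,\mathbb{Z}_4),\quad \mathrm{SL}(2,\mathbb{Z}_9),\quad \mathrm{SL}(3,\mathbb{Z}_4),\quad \mathrm{SL}(4,\mathbb{Z}_4).$$ In particular, for $G=\mathrm{Sp}(2n,\mathbb{Z}_{p^a})$ with $n\ge 2$ there is no proper supplement. -/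

import Mathlib

open scoped Pointwise

/-- The normal subgroup `N` of `G` has a proper supplement in `G`: there is a proper subgroup `S`
of `G` with `N S = G`. -/
def HasProperSupplement {G : Type*} [Group G] (N : Subgroup G) : Prop :=
  ∃ S : Subgroup G, S ≠ ⊤ ∧ (N : Set G) * (S : Set G) = Set.univ

/-- The homomorphism of symplectic groups induced entrywise by a ring homomorphism. -/
def symplecticMap (l : Type*) [DecidableEq l] [Fintype l] {R S : Type*} [CommRing R] [CommRing S]
    (f : R →+* S) : Matrix.symplecticGroup l R →* Matrix.symplecticGroup l S where
  toFun A := ⟨(A : Matrix (l ⊕ l) (l ⊕ l) R).map f, SymplecticGroup.map_mem A.2 f⟩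
  map_one' := Subtype.ext (Matrix.map_one f (map_zero f) (map_one f))
  map_mul' A B := Subtype.ext (Matrix.map_mul (f := f))

/-- The kernel `K_r` of reduction modulo `r` on `SL(n, ℤ/m)`, where `r ∣ m`. -/
def kerSL (n : ℕ) {m r : ℕ} (h : r ∣ m) :
    Subgroup (Matrix.SpecialLinearGroup (Fin n) (ZMod m)) :=
  (Matrix.SpecialLinearGroup.map (ZMod.castHom h (ZMod r))).ker

/-- The kernel `K_r` of reduction modulo `r` on `Sp(2n, ℤ/m)`, where `r ∣ m`. The matrices have
size `2n`, with rows and columns indexed by `Fin n ⊕ Fin n`. -/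
def kerSp (n : ℕ) {m r : ℕ} (h : r ∣ m) :
    Subgroup (Matrix.symplecticGroup (Fin n) (ZMod m)) :=
  (symplecticMap (Fin n) (ZMod.castHom h (ZMod r))).ker

/-! Put ϖ = p^(a-1), so ϖ² = 0, and 1 + ϖX ↦ X mod p identifies the kernel K with an additive group
of matrices over F_p: those of trace zero for SL, those of the form xJ with x symmetric for Sp. If S
supplements K, every element of G agrees with one of S modulo ϖ. Hence S ∩ K becomes a subgroup L
(`topLayer`, or `symplecticLayer` in terms of x) stable under transvections, and S = G once L is
everything.

Elements of L come from p-th powers. For N² = 0, a lift of 1 + p^(a-2) N with a ≥ 3, or of 1 + N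
with a = 2 and p ≥ 5, has p-th power 1 + ϖN. For a = 2 and p = 3 or p = 2, a lift 1 + N + ϖY adds an
error NYN or NY + YN to N. If L were too small, these errors would have to cancel entries of N for
all lifts at once, which contradicts the product rule for lifts (`mul_lift_eq`) or, for SL with p =
2, the commutators of lifts. That needs n ≥ 3 for SL and p = 3, n ≥ 5 for SL and p = 2, and n ≥ 2
for Sp. Module lemmas (`IsTransvectionStable.single_mem`, `IsSymplecticStable.symm_mem_of_single`)
then enlarge one good element to all of L.

In the four remaining groups a supplement is the stabilizer, under A ↦ gAgᵀ, of a finite set of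
matrices. It contains lifts of generators of SL(n, p) but misses an explicit element of K. -/

open Matrix

/-! ### Supplements as stabilizers of finite sets of forms -/

/-- The elements of `SL(n, R)` whose congruence action `A ↦ g A gᵀ` preserves the set `Φ`. -/
def congruenceStabilizer {n : ℕ} {R : Type*} [CommRing R] (Φ : Set (Matrix (Fin n) (Fin n) R)) :
    Subgroup (Matrix.SpecialLinearGroup (Fin n) R) where
  carrier := {g | ∀ A, A ∈ Φ ↔ g.1 * A * g.1ᵀ ∈ Φ}
  one_mem' A := by simp
  mul_mem' {g h} hg hh A := by
    rw [hh A, hg _]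
    simp [Matrix.mul_assoc]
  inv_mem' {g} hg A := by
    rw [hg (g⁻¹.1 * A * g⁻¹.1ᵀ)]
    have h1 : g.1 * g⁻¹.1 = 1 := congrArg Subtype.val (mul_inv_cancel g)
    have h2 : g⁻¹.1ᵀ * g.1ᵀ = 1 := by rw [← transpose_mul, h1, transpose_one]
    have : g.1 * (g⁻¹.1 * A * g⁻¹.1ᵀ) * g.1ᵀ = (g.1 * g⁻¹.1) * A * (g⁻¹.1ᵀ * g.1ᵀ) := by
      simp only [Matrix.mul_assoc]
    rw [this, h1, h2, Matrix.one_mul, Matrix.mul_one]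

/-- The action of g is injective, so it maps the finite set Φ onto itself and nothing outside Φ
enters it. -/
theorem mem_congruenceStabilizer_of_maps {n : ℕ} {R : Type*} [CommRing R]
    {Φ : Set (Matrix (Fin n) (Fin n) R)} (hΦ : Φ.Finite) {g : Matrix.SpecialLinearGroup (Fin n) R}
    (hg : ∀ A ∈ Φ, g.1 * A * g.1ᵀ ∈ Φ) : g ∈ congruenceStabilizer Φ := by
  have h1 : g⁻¹.1 * g.1 = 1 := congrArg Subtype.val (inv_mul_cancel g)
  have h2 : g.1ᵀ * g⁻¹.1ᵀ = 1 := by rw [← transpose_mul, h1, transpose_one]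
  have hback : ∀ A, g⁻¹.1 * (g.1 * A * g.1ᵀ) * g⁻¹.1ᵀ = A := fun A => by
    have : g⁻¹.1 * (g.1 * A * g.1ᵀ) * g⁻¹.1ᵀ = (g⁻¹.1 * g.1) * A * (g.1ᵀ * g⁻¹.1ᵀ) := by
      simp only [Matrix.mul_assoc]
    rw [this, h1, h2, Matrix.one_mul, Matrix.mul_one]
  have hinj : Function.Injective fun A => g.1 * A * g.1ᵀ := fun A B hAB => by
    rw [← hback A, ← hback B]
    exact congrArg (fun X => g⁻¹.1 * X * g⁻¹.1ᵀ) hAB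
  have himg : (fun A => g.1 * A * g.1ᵀ) '' Φ = Φ :=
    Set.eq_of_subset_of_ncard_le (by rintro _ ⟨A, hA, rfl⟩; exact hg A hA)
      (by rw [Set.ncard_image_of_injective _ hinj]) hΦ
  refine fun A => ⟨hg A, fun hA => ?_⟩
  rw [← himg] at hA
  obtain ⟨B, hB, hBA⟩ := hA
  exact hinj hBA ▸ hB

/-- A subgroup of `SL(n, K)` containing the transvections with coefficient one and the diagonal
matrices is everything, for `K` a prime field. -/
theorem subgroup_eq_top_of_transvection_mem {n r : ℕ} [Fact r.Prime]
    (T : Subgroup (Matrix.SpecialLinearGroup (Fin n) (ZMod r)))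
    (ht : ∀ i j, i ≠ j → ∃ s ∈ T, (s : Matrix (Fin n) (Fin n) (ZMod r)) = transvection i j 1)
    (hd : ∀ D : Fin n → ZMod r, ∏ i, D i = 1 → ∃ s ∈ T, (s : Matrix (Fin n) (Fin n) (ZMod r)) = diagonal D) : T = ⊤ := by
  have htc : ∀ (i j : Fin n), i ≠ j → ∀ c : ℕ, ∃ s ∈ T, (s : Matrix (Fin n) (Fin n) (ZMod r)) = transvection i j (c : ZMod r) := by
    intro i j hij c
    obtain ⟨s, hs, hs1⟩ := ht i j hij
    refine ⟨s ^ c, pow_mem hs c, ?_⟩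
    induction c with
    | zero => simp
    | succ c ih =>
      rw [pow_succ, Matrix.SpecialLinearGroup.coe_mul, ih, hs1, transvection_mul_transvection_same i j hij, Nat.cast_succ]
  have htl : ∀ L : List (TransvectionStruct (Fin n) (ZMod r)),
      ∃ s ∈ T, (s : Matrix (Fin n) (Fin n) (ZMod r)) = (L.map TransvectionStruct.toMatrix).prod := by
    intro L
    induction L with
    | nil => exact ⟨1, one_mem _, by simp⟩
    | cons t L ih =>
      obtain ⟨s, hs, hs1⟩ := ih
      obtain ⟨u, hu, hu1⟩ := htc t.i t.j t.hij t.c.val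
      refine ⟨u * s, mul_mem hu hs, ?_⟩
      rw [Matrix.SpecialLinearGroup.coe_mul, hs1, hu1]
      simp [TransvectionStruct.toMatrix]
  rw [eq_top_iff]
  intro g _
  obtain ⟨L, L', D, hg⟩ := Pivot.exists_list_transvec_mul_diagonal_mul_list_transvec (g : Matrix (Fin n) (Fin n) (ZMod r))
  have hD : ∏ i, D i = 1 := by
    have := congrArg det hg
    simpa [TransvectionStruct.det_toMatrix_prod] using this.symm
  obtain ⟨s, hs, hs1⟩ := htl L
  obtain ⟨s', hs', hs1'⟩ := htl L'
  obtain ⟨d, hd, hd1⟩ := hd D hD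
  have : g = s * d * s' := Subtype.ext (by simp [hg, hs1, hs1', hd1])
  rw [this]
  exact mul_mem (mul_mem hs hd) hs'

/-- By `ht` and `hd` the stabilizer of Φ surjects onto SL(n, ZMod r), so it meets every coset of the
kernel; `hp` keeps it proper. -/
theorem hasProperSupplement_of_congruence_stable {n m r : ℕ} (h : r ∣ m) [Fact r.Prime] [NeZero m]
    (Φ : Set (Matrix (Fin n) (Fin n) (ZMod m)))
    (ht : ∀ i j, i ≠ j → ∃ s : Matrix (Fin n) (Fin n) (ZMod m), s.det = 1 ∧
      (∀ A ∈ Φ, s * A * sᵀ ∈ Φ) ∧ s.map (ZMod.castHom h (ZMod r)) = transvection i j 1)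
    (hd : ∀ D : Fin n → ZMod r, ∏ i, D i = 1 → ∃ s : Matrix (Fin n) (Fin n) (ZMod m), s.det = 1 ∧
      (∀ A ∈ Φ, s * A * sᵀ ∈ Φ) ∧ s.map (ZMod.castHom h (ZMod r)) = diagonal D)
    (hp : ∃ g : Matrix (Fin n) (Fin n) (ZMod m), g.det = 1 ∧ ∃ A ∈ Φ, g * A * gᵀ ∉ Φ) :
    HasProperSupplement (kerSL n h) := by
  have hΦ : Φ.Finite := Set.toFinite Φ
  refine ⟨congruenceStabilizer Φ, ?_, ?_⟩
  · intro htop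
    obtain ⟨g, hg, A, hA, hgA⟩ := hp
    let g' : Matrix.SpecialLinearGroup (Fin n) (ZMod m) := ⟨g, hg⟩
    have : g' ∈ congruenceStabilizer Φ :=
      htop ▸ Subgroup.mem_top _
    exact hgA ((this A).1 hA)
  · have hmap : (congruenceStabilizer Φ).map
        (Matrix.SpecialLinearGroup.map (n := Fin n) (ZMod.castHom h (ZMod r))) = ⊤ := by
      refine subgroup_eq_top_of_transvection_mem _ (fun i j hij => ?_) fun D hD => ?_
      · obtain ⟨s, hs, hsΦ, hs1⟩ := ht i j hij
        let s' : Matrix.SpecialLinearGroup (Fin n) (ZMod m) := ⟨s, hs⟩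
        exact ⟨_, ⟨s', mem_congruenceStabilizer_of_maps hΦ hsΦ, rfl⟩, hs1⟩
      · obtain ⟨s, hs, hsΦ, hs1⟩ := hd D hD
        let s' : Matrix.SpecialLinearGroup (Fin n) (ZMod m) := ⟨s, hs⟩
        exact ⟨_, ⟨s', mem_congruenceStabilizer_of_maps hΦ hsΦ, rfl⟩, hs1⟩
    refine Set.eq_univ_of_forall fun g => ?_
    have hg : Matrix.SpecialLinearGroup.map (ZMod.castHom h (ZMod r)) g ∈ (congruenceStabilizer Φ).map
        (Matrix.SpecialLinearGroup.map (n := Fin n) (ZMod.castHom h (ZMod r))) := hmap ▸ Subgroup.mem_top _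
    obtain ⟨s, hs, hsg⟩ := hg
    refine Set.mem_mul.2 ⟨g * s⁻¹, ?_, s, hs, by simp⟩
    change _ = _
    rw [map_mul, map_inv, hsg, mul_inv_cancel]

theorem exists_diagonal_lift_of_two {n m : ℕ} (h : 2 ∣ m)
    (Φ : Set (Matrix (Fin n) (Fin n) (ZMod m))) (D : Fin n → ZMod 2) (hD : ∏ i, D i = 1) :
    ∃ s : Matrix (Fin n) (Fin n) (ZMod m), s.det = 1 ∧
      (∀ A ∈ Φ, s * A * sᵀ ∈ Φ) ∧ s.map (ZMod.castHom h (ZMod 2)) = diagonal D := by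
  have hD1 : D = fun _ => 1 := by
    funext i
    have hne : D i ≠ 0 := fun h0 => by
      rw [Finset.prod_eq_zero (Finset.mem_univ i) h0] at hD
      exact zero_ne_one hD
    revert hne
    generalize D i = x
    revert x
    decide
  refine ⟨1, by simp, by simp, ?_⟩
  rw [hD1, Matrix.map_one _ (map_zero _) (map_one _), diagonal_one]

theorem hasProperSupplement_SL_two_four (h : 2 ∣ 4) : HasProperSupplement (kerSL 2 h) := by
  -- Both lifted transvections below swap these two matrices.
  refine hasProperSupplement_of_congruence_stable h {!![1, 0; 3, 3], !![3, 1; 0, 1]} ?_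
    (exists_diagonal_lift_of_two h _) ⟨!![1, 2; 0, 1], by decide, !![1, 0; 3, 3], by simp, ?_⟩
  · intro i j hij
    have key : (i = 0 ∧ j = 1) ∨ (i = 1 ∧ j = 0) := by
      revert i j
      decide
    obtain ⟨rfl, rfl⟩ | ⟨rfl, rfl⟩ := key
    · refine ⟨!![1, 1; 2, 3], by decide, ?_, by decide +revert⟩
      rintro A (rfl | rfl)
      · right
        decide
      · left
        decide
    · refine ⟨!![1, 2; 1, 3], by decide, ?_, by decide +revert⟩
      rintro A (rfl | rfl)
      · right
        decide
      · left
        decide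
  · rintro (h1 | h1)
    · revert h1
      decide
    · revert h1
      decide

/-- The lift G i j permutes the forms F only up to the translation C i j, which cancels in
differences; Φ is the set of differences. Entries are natural numbers compared modulo m, which
leaves the hypotheses to kernel arithmetic. -/
theorem hasProperSupplement_of_form_permutation {n N m : ℕ} [NeZero m] (h : 2 ∣ m)
    (F : Fin N → Matrix (Fin n) (Fin n) ℕ) (G C : Fin n → Fin n → Matrix (Fin n) (Fin n) ℕ)
    (σ : Fin n → Fin n → Fin N → Fin N)
    (hdet : ∀ i j, i ≠ j → ((G i j).map (Nat.castRingHom (ZMod m))).det = 1)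
    (hred : ∀ i j, i ≠ j → ∀ k l, G i j k l % 2 = (1 + single i j 1 : Matrix _ _ ℕ) k l % 2)
    (hF : ∀ i j, i ≠ j → ∀ a k l,
      (G i j * F a * (G i j)ᵀ + C i j) k l % m = F (σ i j a) k l % m)
    (g : Matrix (Fin n) (Fin n) ℕ) (hg : (g.map (Nat.castRingHom (ZMod m))).det = 1)
    (A : Matrix (Fin n) (Fin n) ℕ) (hA : ∃ a b, ∀ k l, (A + F b) k l % m = F a k l % m)
    (hgA : ∀ a b, ∃ k l, (g * A * gᵀ + F b) k l % m ≠ F a k l % m) :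
    HasProperSupplement (kerSL n h) := by
  set φ := Nat.castRingHom (ZMod m) with hφ
  have hcast : ∀ X Y : Matrix (Fin n) (Fin n) ℕ,
      X.map φ = Y.map φ ↔ ∀ k l, X k l % m = Y k l % m := fun X Y => by
    rw [← Matrix.ext_iff]
    exact forall₂_congr fun k l => ZMod.natCast_eq_natCast_iff _ _ _
  refine hasProperSupplement_of_congruence_stable h
    {A | ∃ a b, A + (F b).map φ = (F a).map φ} (fun i j hij => ?_)
    (exists_diagonal_lift_of_two h _)
    ⟨g.map φ, hg, A.map φ, ?_, ?_⟩
  · refine ⟨(G i j).map φ, hdet i j hij, ?_, ?_⟩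
    · have key : ∀ a, (G i j).map φ * (F a).map φ * ((G i j).map φ)ᵀ + (C i j).map φ =
          (F (σ i j a)).map φ := fun a => by
        rw [← (hcast _ _).2 (hF i j hij a), Matrix.map_add _ (map_add φ), Matrix.map_mul,
          Matrix.map_mul, transpose_map]
      rintro X ⟨a, b, hX⟩
      refine ⟨σ i j a, σ i j b, ?_⟩
      rw [← key a, ← key b, ← hX]
      simp only [Matrix.mul_add, Matrix.add_mul, add_assoc]
    · ext k l
      have h1 := (ZMod.natCast_eq_natCast_iff _ _ 2).2 (hred i j hij k l)
      simp only [Matrix.map_apply, hφ, Nat.coe_castRingHom, map_natCast, h1]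
      simp [transvection, Matrix.one_apply, Matrix.single_apply]
  · obtain ⟨a, b, hab⟩ := hA
    refine ⟨a, b, ?_⟩
    rw [← (hcast _ _).2 hab, Matrix.map_add _ (map_add φ)]
  · rintro ⟨a, b, hab⟩
    obtain ⟨k, l, hkl⟩ := hgA a b
    refine hkl ((hcast _ _).1 ?_ k l)
    rw [← hab, Matrix.map_add _ (map_add φ), Matrix.map_mul, Matrix.map_mul, transpose_map]

/-! ### Explicit data for the exceptional groups -/

def alternatingEightGen : Fin 4 → Fin 4 → Matrix (Fin 4) (Fin 4) ℕ
  | 0, 1 => !![3, 3, 2, 0; 0, 1, 0, 0; 0, 0, 3, 2; 0, 0, 2, 1]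
  | 0, 2 => !![3, 2, 1, 0; 0, 3, 0, 2; 0, 0, 1, 0; 0, 2, 2, 1]
  | 0, 3 => !![3, 2, 2, 1; 0, 3, 2, 2; 0, 2, 1, 2; 0, 0, 0, 1]
  | 1, 0 => !![1, 0, 0, 0; 3, 3, 2, 0; 0, 0, 3, 2; 0, 0, 2, 1]
  | 1, 2 => !![3, 0, 0, 2; 2, 3, 3, 2; 0, 0, 1, 0; 2, 0, 2, 1]
  | 1, 3 => !![3, 0, 2, 2; 2, 3, 0, 1; 2, 0, 1, 2; 0, 0, 0, 1]
  | 2, 0 => !![1, 0, 0, 0; 0, 3, 0, 2; 1, 2, 3, 2; 0, 2, 0, 1]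
  | 2, 1 => !![3, 0, 0, 2; 0, 1, 0, 0; 2, 3, 3, 2; 2, 2, 0, 1]
  | 2, 3 => !![3, 2, 0, 2; 2, 1, 0, 2; 0, 0, 3, 1; 0, 0, 0, 1]
  | 3, 0 => !![3, 0, 0, 0; 2, 3, 2, 0; 2, 2, 1, 0; 1, 0, 0, 1]
  | 3, 1 => !![3, 2, 2, 0; 0, 3, 0, 0; 2, 0, 1, 0; 0, 1, 0, 1]
  | 3, 2 => !![3, 2, 0, 0; 2, 1, 0, 0; 0, 0, 3, 0; 0, 0, 1, 1]
  | _, _ => 1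

/-- The model is SL(4, 2) ≅ A_8 acting on eight points: each transvection permutes the forms, up to
translation, as four disjoint transpositions. -/
def alternatingEightForm : Fin 8 → Matrix (Fin 4) (Fin 4) ℕ :=
  ![
   !![0, 0, 0, 0; 0, 0, 0, 0; 0, 0, 0, 0; 0, 0, 0, 0],
   !![0, 0, 0, 1; 0, 0, 1, 0; 0, 3, 0, 3; 3, 0, 1, 0],
   !![0, 0, 3, 1; 0, 0, 0, 1; 1, 0, 0, 3; 3, 3, 1, 0],
   !![0, 2, 1, 0; 2, 0, 3, 1; 3, 1, 0, 3; 0, 3, 1, 0],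
   !![0, 1, 0, 2; 3, 0, 0, 2; 0, 0, 0, 1; 2, 2, 3, 0],
   !![0, 3, 3, 1; 1, 0, 3, 0; 1, 1, 0, 2; 3, 0, 2, 0],
   !![0, 1, 2, 3; 3, 0, 3, 1; 2, 1, 0, 2; 1, 3, 2, 0],
   !![0, 1, 3, 0; 3, 0, 2, 3; 1, 2, 0, 2; 0, 1, 2, 0]]

def alternatingEightPerm : Fin 4 → Fin 4 → Fin 8 → Fin 8
  | 0, 1 => ![4, 5, 7, 6, 0, 1, 3, 2]
  | 0, 2 => ![7, 3, 4, 1, 2, 6, 5, 0]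
  | 0, 3 => ![5, 4, 3, 2, 1, 0, 7, 6]
  | 1, 0 => ![4, 6, 5, 7, 0, 2, 1, 3]
  | 1, 2 => ![6, 4, 3, 2, 1, 7, 0, 5]
  | 1, 3 => ![7, 2, 1, 4, 3, 6, 5, 0]
  | 2, 0 => ![3, 2, 1, 0, 7, 6, 5, 4]
  | 2, 1 => ![1, 0, 3, 2, 5, 4, 7, 6]
  | 2, 3 => ![4, 5, 6, 7, 0, 1, 2, 3]
  | 3, 0 => ![1, 0, 3, 2, 6, 7, 4, 5]
  | 3, 1 => ![2, 3, 0, 1, 7, 6, 5, 4]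
  | 3, 2 => ![4, 6, 7, 5, 0, 3, 1, 2]
  | _, _ => id

def kleinFourteenGen : Fin 3 → Fin 3 → Matrix (Fin 3) (Fin 3) ℕ
  | 0, 1 => !![1, 1, 0; 0, 3, 0; 0, 0, 3]
  | 0, 2 => !![3, 0, 1; 0, 3, 2; 0, 0, 1]
  | 1, 0 => !![1, 0, 0; 1, 3, 2; 2, 0, 3]
  | 1, 2 => !![3, 0, 0; 2, 1, 1; 0, 0, 3]
  | 2, 0 => !![1, 0, 0; 2, 3, 0; 1, 2, 3]
  | 2, 1 => !![3, 0, 0; 0, 3, 0; 0, 1, 1]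
  | _, _ => 1

/-- Seven pairs ±F, one above each nonzero alternating form over F_2 in dimension three; no
translation is needed. -/
def kleinFourteenForm : Fin 14 → Matrix (Fin 3) (Fin 3) ℕ :=
  ![
   !![0, 0, 0; 0, 0, 1; 0, 3, 0],
   !![0, 0, 3; 0, 0, 1; 1, 3, 0],
   !![0, 0, 0; 0, 0, 3; 0, 1, 0],
   !![0, 1, 0; 3, 0, 3; 0, 1, 0],
   !![0, 1, 3; 3, 0, 1; 1, 3, 0],
   !![0, 0, 1; 0, 0, 3; 3, 1, 0],
   !![0, 3, 1; 1, 0, 3; 3, 1, 0],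
   !![0, 2, 1; 2, 0, 2; 3, 2, 0],
   !![0, 3, 0; 1, 0, 1; 0, 3, 0],
   !![0, 3, 2; 1, 0, 0; 2, 0, 0],
   !![0, 3, 3; 1, 0, 0; 1, 0, 0],
   !![0, 1, 1; 3, 0, 0; 3, 0, 0],
   !![0, 2, 3; 2, 0, 2; 1, 2, 0],
   !![0, 1, 2; 3, 0, 0; 2, 0, 0]]

def kleinFourteenPerm : Fin 3 → Fin 3 → Fin 14 → Fin 14
  | 0, 1 => ![1, 0, 5, 6, 8, 2, 3, 7, 4, 13, 11, 10, 12, 9]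
  | 0, 2 => ![3, 6, 8, 0, 5, 4, 1, 12, 2, 9, 11, 10, 7, 13]
  | 1, 0 => ![0, 7, 2, 8, 11, 12, 10, 1, 3, 13, 6, 4, 5, 9]
  | 1, 2 => ![2, 4, 0, 8, 1, 6, 5, 11, 3, 9, 12, 7, 10, 13]
  | 2, 0 => ![0, 5, 2, 9, 10, 1, 11, 12, 13, 3, 4, 6, 7, 8]
  | 2, 1 => ![2, 5, 0, 4, 3, 1, 8, 7, 6, 10, 9, 13, 12, 11]
  | _, _ => id


set_option maxRecDepth 100000 in
theorem hasProperSupplement_SL_three_four (h : 2 ∣ 4) : HasProperSupplement (kerSL 3 h) := by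
  refine hasProperSupplement_of_form_permutation h kleinFourteenForm kleinFourteenGen
    (fun _ _ => 0) kleinFourteenPerm ?_ (by decide +kernel) (by decide +kernel)
    !![1, 2, 0; 0, 1, 0; 0, 0, 1] ?_ !![0, 1, 1; 3, 0, 1; 3, 3, 0]
    ⟨0, 10, by decide +kernel⟩ (by decide +kernel)
  · decide +kernel
  · decide +kernel

set_option maxRecDepth 100000 in
theorem hasProperSupplement_SL_four_four (h : 2 ∣ 4) : HasProperSupplement (kerSL 4 h) := by
  refine hasProperSupplement_of_form_permutation h alternatingEightForm alternatingEightGen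
    -- Form number 0 is zero, so the translation has to be the form to which 0 is sent.
    (fun i j => alternatingEightForm (alternatingEightPerm i j 0)) alternatingEightPerm ?_
    (by decide +kernel) (by decide +kernel)
    !![1, 2, 0, 0; 0, 1, 0, 0; 0, 0, 1, 0; 0, 0, 0, 1] ?_
    !![0, 0, 1, 1; 0, 0, 3, 2; 3, 1, 0, 0; 3, 2, 0, 0]
    ⟨7, 6, by decide +kernel⟩ (by decide +kernel)
  · decide +kernel
  · decide +kernel

theorem hasProperSupplement_SL_two_nine (h : 3 ∣ 9) : HasProperSupplement (kerSL 2 h) := by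
  refine hasProperSupplement_of_congruence_stable h
    {!![1, 0; 1, 1], !![3, 1; 2, 1], !![7, 7; 8, 3], !![7, 8; 0, 4]} ?_ ?_
    ⟨!![1, 3; 0, 1], by decide, !![1, 0; 1, 1], by simp, ?_⟩
  · intro i j hij
    have key : (i = 0 ∧ j = 1) ∨ (i = 1 ∧ j = 0) := by
      revert i j
      decide
    obtain ⟨rfl, rfl⟩ | ⟨rfl, rfl⟩ := key
    · refine ⟨!![1, 1; 6, 7], by decide, ?_, by decide +revert⟩
      rintro A (rfl | rfl | rfl | rfl) <;> decide +kernel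
    · refine ⟨!![1, 6; 4, 7], by decide, ?_, by decide +revert⟩
      rintro A (rfl | rfl | rfl | rfl) <;> decide +kernel
  · intro D hD
    have key : D = (fun _ => 1) ∨ D = fun _ => -1 := by
      revert D
      decide
    obtain rfl | rfl := key
    · refine ⟨1, by simp, by simp, ?_⟩
      rw [Matrix.map_one _ (map_zero _) (map_one _), diagonal_one]
    -- The lift is -1, which acts trivially by congruence.
    · refine ⟨!![8, 0; 0, 8], by decide, ?_, by decide +revert⟩
      rintro A (rfl | rfl | rfl | rfl) <;> decide +kernel
  · decide +kernel

/-! ### Submodules of matrices over F_p stable under transvections -/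

section TransvectionModule

variable {p : ℕ} [Fact p.Prime] {m : Type*} [Fintype m] [DecidableEq m]

theorem AddSubgroup.zmod_smul_mem {V : Type*} [AddCommGroup V] [Module (ZMod p) V]
    (L : AddSubgroup V) (c : ZMod p) {x : V} (hx : x ∈ L) : c • x ∈ L := by
  rw [← ZMod.natCast_zmod_val c, Nat.cast_smul_eq_nsmul]
  exact nsmul_mem hx _

theorem AddSubgroup.mem_of_zmod_smul_mem {V : Type*} [AddCommGroup V] [Module (ZMod p) V]
    (L : AddSubgroup V) {c : ZMod p} (hc : c ≠ 0) {x : V} (hx : c • x ∈ L) : x ∈ L := by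
  simpa [smul_smul, inv_mul_cancel₀ hc] using L.zmod_smul_mem c⁻¹ hx

omit [Fintype m] in
theorem single_eq_smul_single_one {R : Type*} [CommRing R] (i j : m) (c : R) :
    single i j c = c • single i j (1 : R) := by
  rw [smul_single, smul_eq_mul, mul_one]

/-- Additive groups of matrices stable under conjugation by the transvections `1 + E_ij`. -/
def IsTransvectionStable (L : AddSubgroup (Matrix m m (ZMod p))) : Prop :=
  ∀ i j, i ≠ j → ∀ x ∈ L, (1 + single i j 1) * x * (1 - single i j 1) ∈ L

variable {L : AddSubgroup (Matrix m m (ZMod p))}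

/-- With E = E_ij, (1 + E)x(1 - E) - x = Ex - xE - ExE, and ExE = x_ji E. -/
theorem IsTransvectionStable.bracket_mem (hL : IsTransvectionStable L) {i j : m} (hij : i ≠ j)
    {x : Matrix m m (ZMod p)} (hx : x ∈ L) :
    single i j 1 * x - x * single i j 1 - x j i • single i j 1 ∈ L := by
  have h := sub_mem (hL i j hij x hx) hx
  have h2 : single i j (1 : ZMod p) * x * single i j 1 = x j i • single i j 1 := by
    rw [single_mul_mul_single, ← single_eq_smul_single_one]
    simp
  rw [← h2]
  convert h using 1
  noncomm_ring

/-- Brackets of opposite units supply E_ii - E_oo for a fixed index o; modulo these and the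
off-diagonal units, x reduces to its trace times E_oo. -/
theorem IsTransvectionStable.mem_of_trace_eq_zero (hL : IsTransvectionStable L)
    (h : ∀ i j, i ≠ j → single i j 1 ∈ L) {x : Matrix m m (ZMod p)} (hx : x.trace = 0) :
    x ∈ L := by
  rcases isEmpty_or_nonempty m with hm | ⟨⟨o⟩⟩
  · rw [Subsingleton.elim x 0]
    exact zero_mem _
  have hoff : ∀ i j, i ≠ j → ∀ c, single i j c ∈ L := fun i j hij c => by
    rw [single_eq_smul_single_one]
    exact L.zmod_smul_mem c (h i j hij)
  have hdiag : ∀ i c, single i i c - single o o c ∈ L := fun i c => by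
    rw [single_eq_smul_single_one, single_eq_smul_single_one o, ← smul_sub]
    refine L.zmod_smul_mem c ?_
    by_cases hi : i = o
    · simp [hi]
    · have := hL.bracket_mem hi (h o i (Ne.symm hi))
      rw [single_mul_single_same, single_mul_single_same] at this
      have h1 := add_mem this (L.zmod_smul_mem (single o i (1 : ZMod p) o i) (h i o hi))
      simpa using h1
  have hrow : ∀ i, ∑ j, single i j (x i j) - single o o (x i i) ∈ L := fun i => by
    rw [← Finset.add_sum_erase _ _ (Finset.mem_univ i), add_sub_right_comm]
    refine add_mem (hdiag i _) (sum_mem fun j hj => hoff i j (Finset.ne_of_mem_erase hj).symm _)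
  have hsum : ∑ i, (∑ j, single i j (x i j) - single o o (x i i)) ∈ L :=
    sum_mem fun i _ => hrow i
  rw [Finset.sum_sub_distrib, ← matrix_eq_sum_single] at hsum
  have : ∑ i, single o o (x i i) = single o o x.trace := by
    simp_rw [single_eq_smul_single_one o o (x _ _)]
    rw [single_eq_smul_single_one o o x.trace, ← Finset.sum_smul]
    rfl
  rwa [this, hx, single_zero, sub_zero] at hsum

theorem IsTransvectionStable.single_mem_of_row (hL : IsTransvectionStable L) {i j k : m}
    (hki : k ≠ i) (hkj : k ≠ j) (h : single i j 1 ∈ L) : single k j 1 ∈ L := by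
  have := hL.bracket_mem hki h
  rw [single_mul_single_same, single_mul_single_of_ne _ _ _ _ hkj.symm,
    single_apply_of_col_ne _ _ hkj.symm] at this
  simpa using this

theorem IsTransvectionStable.single_mem_of_col (hL : IsTransvectionStable L) {i j k : m}
    (hki : k ≠ i) (hkj : k ≠ j) (h : single i j 1 ∈ L) : single i k 1 ∈ L := by
  have := hL.bracket_mem hkj.symm h
  rw [single_mul_single_same, single_mul_single_of_ne _ _ _ _ hki,
    single_apply_of_row_ne hki.symm] at this
  simpa using this

theorem IsTransvectionStable.single_mem (hL : IsTransvectionStable L) (hm : 3 ≤ Fintype.card m)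
    {i j : m} (h : single i j 1 ∈ L) (k l : m) (hkl : k ≠ l) : single k l 1 ∈ L := by
  have h1 : ∀ k, k ≠ j → single k j 1 ∈ L := fun k hk => by
    by_cases hki : k = i
    · rwa [hki]
    · exact hL.single_mem_of_row hki hk h
  have h2 : ∀ k l, k ≠ j → k ≠ l → single k l 1 ∈ L := fun k l hk hkl => by
    by_cases hl : l = j
    · rw [hl]
      exact h1 k hk
    · exact hL.single_mem_of_col hkl.symm hl (h1 k hk)
  by_cases hk : k = j
  · obtain ⟨r, -, hr⟩ := Finset.exists_mem_notMem_of_card_lt_card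
      (s := {j, l}) (t := Finset.univ) ((Finset.card_le_two).trans_lt (by rw [Finset.card_univ]; omega))
    simp only [Finset.mem_insert, Finset.mem_singleton, not_or] at hr
    exact hL.single_mem_of_row (hk.trans_ne (Ne.symm hr.1)) hkl (h2 r l hr.1 hr.2)
  · exact h2 k l hk hkl

/-- Bracketing with the commuting units E_rq and E_kl leaves -x_lr E_kq - x_qk E_rl, and bracketing
with E_rk then keeps only -x_lr E_rq. The indices l and q may coincide. -/
theorem IsTransvectionStable.single_mem_of_apply_ne_zero (hL : IsTransvectionStable L)
    {k l r q : m} (hkl : k ≠ l) (hkr : k ≠ r) (hkq : k ≠ q) (hlr : l ≠ r)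
    (hrq : r ≠ q) {x : Matrix m m (ZMod p)} (hx : x ∈ L) (hne : x l r ≠ 0) :
    single r q 1 ∈ L := by
  have h1 := hL.bracket_mem hkl (hL.bracket_mem hrq hx)
  have e1 : single k l 1 * x * single r q 1 = x l r • single k q (1 : ZMod p) := by
    rw [single_mul_mul_single, ← single_eq_smul_single_one]
    simp
  have e2 : single r q 1 * x * single k l 1 = x q k • single r l (1 : ZMod p) := by
    rw [single_mul_mul_single, ← single_eq_smul_single_one]
    simp
  have e3 : single k l (1 : ZMod p) * single r q 1 = 0 := single_mul_single_of_ne _ _ _ _ hlr _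
  have e4 : single r q (1 : ZMod p) * single k l 1 = 0 :=
    single_mul_single_of_ne _ _ _ _ hkq.symm _
  have e5 : (single r q 1 * x - x * single r q 1 - x q r • single r q 1 :
      Matrix m m (ZMod p)) l k = 0 := by
    rw [Matrix.sub_apply, Matrix.sub_apply, single_mul_apply_of_ne _ _ _ _ _ hlr,
      mul_single_apply_of_ne _ _ _ _ _ hkq, Matrix.smul_apply, single_apply_of_row_ne hlr.symm]
    simp
  have e6 : single k l 1 * (single r q 1 * x - x * single r q 1 - x q r • single r q 1) -
      (single r q 1 * x - x * single r q 1 - x q r • single r q 1) * single k l 1 =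
      -(x l r • single k q (1 : ZMod p)) - x q k • single r l (1 : ZMod p) := by
    rw [← e1, ← e2]
    simp only [mul_sub, sub_mul, mul_smul_comm, smul_mul_assoc, e3, e4, ← mul_assoc]
    simp only [mul_assoc, e4]
    simp
  rw [e5, e6, zero_smul, sub_zero] at h1
  have h2 := hL.bracket_mem hkr.symm h1
  have e7 : (-(x l r • single k q (1 : ZMod p)) - x q k • single r l (1 : ZMod p)) k r = 0 := by
    rw [Matrix.sub_apply, Matrix.neg_apply, Matrix.smul_apply, Matrix.smul_apply, single_apply_of_row_ne hkr.symm,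
      single_apply_of_col_ne _ _ hrq.symm]
    simp
  rw [e7, zero_smul, sub_zero] at h2
  simp only [mul_sub, sub_mul, mul_neg, neg_mul, mul_smul_comm, smul_mul_assoc,
    single_mul_single_same, single_mul_single_of_ne _ _ _ _ hkr,
    single_mul_single_of_ne _ _ _ _ hrq.symm, single_mul_single_of_ne _ _ _ _ hlr] at h2
  refine L.mem_of_zmod_smul_mem hne ?_
  simpa using h2

/-- Bracketing twice with E_kl leaves -2 x_lk E_kl. -/
theorem IsTransvectionStable.single_mem_of_apply_ne_zero_of_odd (hL : IsTransvectionStable L)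
    (hp : p ≠ 2) {k l : m} (hkl : k ≠ l) {x : Matrix m m (ZMod p)} (hx : x ∈ L)
    (hne : x l k ≠ 0) : single k l 1 ∈ L := by
  have h1 := hL.bracket_mem hkl (hL.bracket_mem hkl hx)
  have e1 : single k l 1 * x * single k l 1 = x l k • single k l (1 : ZMod p) := by
    rw [single_mul_mul_single, ← single_eq_smul_single_one]
    simp
  have e3 : single k l (1 : ZMod p) * single k l 1 = 0 :=
    single_mul_single_of_ne _ _ _ _ hkl.symm _
  have e5 : (single k l 1 * x - x * single k l 1 - x l k • single k l 1 :
      Matrix m m (ZMod p)) l k = 0 := by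
    rw [Matrix.sub_apply, Matrix.sub_apply, single_mul_apply_of_ne _ _ _ _ _ hkl.symm,
      mul_single_apply_of_ne _ _ _ _ _ hkl, Matrix.smul_apply, single_apply_of_row_ne hkl]
    simp
  have e6 : single k l 1 * (single k l 1 * x - x * single k l 1 - x l k • single k l 1) -
      (single k l 1 * x - x * single k l 1 - x l k • single k l 1) * single k l 1 =
      (-2 * x l k) • single k l (1 : ZMod p) := by
    rw [mul_smul, ← e1]
    simp only [mul_sub, sub_mul, e3, ← mul_assoc]
    simp only [mul_assoc, e3, neg_smul, two_smul]
    simp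
    abel
  rw [e5, e6, zero_smul, sub_zero] at h1
  refine L.mem_of_zmod_smul_mem (mul_ne_zero (neg_ne_zero.2 ?_) hne) h1
  intro h2
  have h3 : ((2 : ℕ) : ZMod p) = 0 := by exact_mod_cast h2
  rw [ZMod.natCast_eq_zero_iff] at h3
  exact hp ((Nat.prime_dvd_prime_iff_eq Fact.out Nat.prime_two).1 h3)

/-- A nonzero off-diagonal entry anywhere in L yields all units. Otherwise the (i, j) entry of the
bracket with E_ij, namely x_jj - x_ii, must vanish as well. -/
theorem IsTransvectionStable.isScalar_or_single_mem (hL : IsTransvectionStable L)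
    (hm : 4 ≤ Fintype.card m) :
    (∀ x ∈ L, ∀ i j, i ≠ j → x i j = 0 ∧ x i i = x j j) ∨ ∀ i j, i ≠ j → single i j 1 ∈ L := by
  by_contra! hcon
  obtain ⟨⟨x, hx, i, j, hij, hxij⟩, k, l, hkl, hS⟩ := hcon
  have hzero : ∀ y ∈ L, ∀ i j, i ≠ j → y i j = 0 := by
    intro y hy i j hij
    by_contra hne
    obtain ⟨r, -, hr⟩ := Finset.exists_mem_notMem_of_card_lt_card
      (s := {i, j}) (t := Finset.univ)
      ((Finset.card_le_two).trans_lt (by rw [Finset.card_univ]; omega))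
    obtain ⟨q, -, hq⟩ := Finset.exists_mem_notMem_of_card_lt_card
      (s := {i, j, r}) (t := Finset.univ)
      ((Finset.card_le_three).trans_lt (by rw [Finset.card_univ]; omega))
    simp only [Finset.mem_insert, Finset.mem_singleton, not_or] at hr hq
    exact hS (hL.single_mem (by omega) (hL.single_mem_of_apply_ne_zero hr.1 hr.2
      (Ne.symm hq.2.2) hij (Ne.symm hq.2.1) hy hne) k l hkl)
  have h1 := hzero _ (hL.bracket_mem hij hx) i j hij
  rw [Matrix.sub_apply, Matrix.sub_apply, single_mul_apply_same, mul_single_apply_same,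
    hzero x hx j i hij.symm, zero_smul, Matrix.zero_apply, one_mul, mul_one, sub_zero, sub_eq_zero] at h1
  exact hxij (hzero x hx i j hij) h1.symm

end TransvectionModule

/-! ### The top congruence layer and p-th powers of lifts -/

/-- The ideal `ϖ R` of `R` has square zero and is identified with `ZMod p` by `π z ↦ ϖ z`, as for
`R = ℤ/p^a` with `a ≥ 2` and `ϖ = p^(a-1)`. -/
structure IsTopLayer {p : ℕ} {R : Type*} [CommRing R] (π : R →+* ZMod p) (ϖ : R) : Prop where
  surjective : Function.Surjective π
  mul_eq_zero_iff : ∀ z, ϖ * z = 0 ↔ π z = 0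
  map_self : π ϖ = 0

section TopLayer

variable {p : ℕ} {R : Type*} [CommRing R] {π : R →+* ZMod p} {ϖ : R}
  {m : Type*} [Fintype m] [DecidableEq m] {H : Type*} [Group H]

theorem IsTopLayer.mul_self (hϖ : IsTopLayer π ϖ) : ϖ * ϖ = 0 :=
  (hϖ.mul_eq_zero_iff ϖ).2 hϖ.map_self

omit [Fintype m] [DecidableEq m] in
theorem IsTopLayer.smul_eq_smul_iff (hϖ : IsTopLayer π ϖ) {X Y : Matrix m m R} :
    ϖ • X = ϖ • Y ↔ X.map π = Y.map π := by
  rw [← Matrix.ext_iff, ← Matrix.ext_iff]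
  refine forall₂_congr fun i j => ?_
  rw [Matrix.smul_apply, Matrix.smul_apply, smul_eq_mul, smul_eq_mul, ← sub_eq_zero, ← mul_sub,
    hϖ.mul_eq_zero_iff, map_sub, sub_eq_zero, Matrix.map_apply, Matrix.map_apply]

omit [Fintype m] [DecidableEq m] in
theorem IsTopLayer.smul_smul (hϖ : IsTopLayer π ϖ) (X : Matrix m m R) : ϖ • ϖ • X = 0 := by
  rw [_root_.smul_smul, hϖ.mul_self, zero_smul]

/-- The reductions of the matrices `X` with `1 + ϖ X` in the image of `ρ`. -/
def topLayer (hϖ : IsTopLayer π ϖ) (ρ : H →* Matrix m m R) : AddSubgroup (Matrix m m (ZMod p)) where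
  carrier := {x | ∃ s, ∃ X : Matrix m m R, ρ s = 1 + ϖ • X ∧ X.map π = x}
  zero_mem' := ⟨1, 0, by simp, by ext; simp⟩
  add_mem' := by
    rintro _ _ ⟨s, X, hs, rfl⟩ ⟨t, Y, ht, rfl⟩
    refine ⟨s * t, X + Y, ?_, Matrix.map_add _ (map_add π) _ _⟩
    rw [map_mul, hs, ht, add_mul, one_mul, mul_add, mul_one, smul_mul_smul_comm, hϖ.mul_self,
      zero_smul, add_zero, smul_add, add_assoc, add_comm (ϖ • Y)]
  neg_mem' := by
    rintro _ ⟨s, X, hs, rfl⟩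
    refine ⟨s⁻¹, -X, ?_, by ext; simp⟩
    have h1 : ρ s⁻¹ * ρ s = 1 := by rw [← map_mul, inv_mul_cancel, map_one]
    have h2 : ρ s * (1 + ϖ • (-X)) = 1 := by
      rw [hs, add_mul, one_mul, mul_add, mul_one, smul_mul_smul_comm, hϖ.mul_self, zero_smul]
      simp
    calc ρ s⁻¹ = ρ s⁻¹ * (ρ s * (1 + ϖ • (-X))) := by rw [h2, mul_one]
      _ = _ := by rw [← mul_assoc, h1, one_mul]

variable (hϖ : IsTopLayer π ϖ) {ρ : H →* Matrix m m R}

theorem mem_topLayer {s : H} {X : Matrix m m R} (h : ρ s = 1 + ϖ • X) :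
    X.map π ∈ topLayer hϖ ρ := ⟨s, X, h, rfl⟩

theorem exists_of_mem_topLayer {X : Matrix m m R} (h : X.map π ∈ topLayer hϖ ρ) :
    ∃ s, ρ s = 1 + ϖ • X := by
  obtain ⟨s, Y, hs, hY⟩ := h
  exact ⟨s, by rw [hs, hϖ.smul_eq_smul_iff.2 hY]⟩

/-- Conjugation takes 1 + ϖX to 1 + ϖ(sXs⁻¹), where the factor ϖ makes only the reduction of s
matter; any lift of P serves. -/
theorem conj_mem_topLayer {P Q x : Matrix m m (ZMod p)} (hPQ : P * Q = 1)
    (hP : ∃ s, (ρ s).map π = P) (hx : x ∈ topLayer hϖ ρ) : P * x * Q ∈ topLayer hϖ ρ := by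
  obtain ⟨s, rfl⟩ := hP
  obtain ⟨t, X, ht, rfl⟩ := hx
  have h1 : ρ s * ρ s⁻¹ = 1 := by rw [← map_mul, mul_inv_cancel, map_one]
  have hQ : (ρ s⁻¹).map π = Q := by
    have h2 : (ρ s⁻¹).map π * (ρ s).map π = 1 := by
      rw [← Matrix.map_mul, ← map_mul, inv_mul_cancel, map_one,
        Matrix.map_one _ (map_zero _) (map_one _)]
    calc (ρ s⁻¹).map π = (ρ s⁻¹).map π * ((ρ s).map π * Q) := by rw [hPQ, mul_one]
      _ = Q := by rw [← mul_assoc, h2, one_mul]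
  rw [← hQ, ← Matrix.map_mul, ← Matrix.map_mul]
  refine mem_topLayer hϖ (s := s * t * s⁻¹) ?_
  rw [map_mul, map_mul, ht, mul_add, mul_one, add_mul, h1, mul_smul_comm, smul_mul_assoc]

theorem one_add_pow_of_pow_four_eq_zero {A : Type*} [Ring A] {X : A} (hX : X ^ 4 = 0) (k : ℕ) :
    (1 + X) ^ k = 1 + (k : A) * X + (k.choose 2 : A) * X ^ 2 + (k.choose 3 : A) * X ^ 3 := by
  induction k with
  | zero => simp
  | succ k ih =>
    have h4 : X ^ 3 * X = 0 := by rw [← pow_succ, hX]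
    have e2 : (k + 1).choose 2 = k + k.choose 2 := by simp [Nat.choose_succ_succ' k 1]
    have e3 : (k + 1).choose 3 = k.choose 2 + k.choose 3 := Nat.choose_succ_succ' k 2
    have e : (1 + X) ^ (k + 1) = 1 + (k : A) * X + (k.choose 2 : A) * X ^ 2 +
        (k.choose 3 : A) * X ^ 3 + X + (k : A) * (X * X) + (k.choose 2 : A) * (X ^ 2 * X) +
        (k.choose 3 : A) * (X ^ 3 * X) := by
      rw [pow_succ, ih]
      noncomm_ring
    rw [e, h4, e2, e3, ← pow_two, ← pow_succ]
    push_cast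
    noncomm_ring

/-- A surviving word other than N has exactly one Y and at most one N on each side of it, hence
length at most three. -/
theorem single_layer_cube {N Y : Matrix m m R} (hϖ : IsTopLayer π ϖ) (hN : N * N = 0) :
    (N + ϖ • Y) ^ 2 = ϖ • (N * Y + Y * N) ∧ (N + ϖ • Y) ^ 3 = ϖ • (N * Y * N) ∧
      (N + ϖ • Y) ^ 4 = 0 := by
  have h2 : (N + ϖ • Y) ^ 2 = ϖ • (N * Y + Y * N) := by
    rw [pow_two, mul_add, add_mul, add_mul, hN, smul_mul_smul_comm, hϖ.mul_self, zero_smul,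
      smul_mul_assoc, mul_smul_comm, smul_add, zero_add, add_zero, add_comm]
  have h3 : (N + ϖ • Y) ^ 3 = ϖ • (N * Y * N) := by
    rw [pow_succ, h2, mul_add, smul_mul_smul_comm, hϖ.mul_self, zero_smul, add_zero,
      smul_mul_assoc, add_mul, mul_assoc Y, hN, mul_zero, add_zero]
  refine ⟨h2, h3, ?_⟩
  rw [pow_succ, h3, mul_add, smul_mul_smul_comm, hϖ.mul_self, zero_smul, add_zero,
    smul_mul_assoc, mul_assoc, hN, mul_zero, smul_zero]

theorem natCast_mul_eq_smul {k : ℕ} (hk : (k : R) = ϖ) (X : Matrix m m R) :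
    (k : Matrix m m R) * X = ϖ • X := by
  rw [← hk, ← nsmul_eq_mul, Nat.cast_smul_eq_nsmul]

/-- The `p`-th power of a lift of a square-zero transvection, for `ϖ = p`. -/
theorem pow_lift_eq (hϖ : IsTopLayer π ϖ) (hp : (p : R) = ϖ) {N Y : Matrix m m R}
    (hN : N * N = 0) :
    (1 + (N + ϖ • Y)) ^ p = 1 + ϖ • N + (p.choose 2 : R) • ϖ • (N * Y + Y * N) +
      (p.choose 3 : R) • ϖ • (N * Y * N) := by
  obtain ⟨h2, h3, h4⟩ := single_layer_cube (Y := Y) hϖ hN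
  rw [one_add_pow_of_pow_four_eq_zero h4, h2, h3, natCast_mul_eq_smul hp, smul_add, hϖ.smul_smul,
    add_zero]
  simp only [← nsmul_eq_mul, Nat.cast_smul_eq_nsmul]

omit [Fintype m] [DecidableEq m] in
theorem natCast_smul_smul_eq_zero (hϖ : IsTopLayer π ϖ) {k : ℕ} (hk : p ∣ k)
    (X : Matrix m m R) : (k : R) • ϖ • X = 0 := by
  rw [_root_.smul_smul, mul_comm, (hϖ.mul_eq_zero_iff _).2, zero_smul]
  rw [map_natCast, ZMod.natCast_eq_zero_iff]
  exact hk

/-- Both binomial coefficients in `pow_lift_eq` are divisible by p because 3 < p. -/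
theorem map_mem_topLayer_of_five_le (hp5 : 5 ≤ p) (hpp : p.Prime) (hp : (p : R) = ϖ) {s : H}
    {N Y : Matrix m m R} (hN : N * N = 0) (hs : ρ s = 1 + N + ϖ • Y) :
    N.map π ∈ topLayer hϖ ρ := by
  refine mem_topLayer hϖ (s := s ^ p) ?_
  rw [map_pow, hs, add_assoc, pow_lift_eq hϖ hp hN,
    natCast_smul_smul_eq_zero hϖ (hpp.dvd_choose_self two_ne_zero (by omega)),
    natCast_smul_smul_eq_zero hϖ (hpp.dvd_choose_self three_ne_zero (by omega)), add_zero, add_zero]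

/-- Here 3 choose 2 vanishes modulo 3, but 3 choose 3 is 1 and the term NYN survives. -/
theorem map_mem_topLayer_of_three (hp3 : p = 3) (hp : (p : R) = ϖ) {s : H}
    {N Y : Matrix m m R} (hN : N * N = 0) (hs : ρ s = 1 + N + ϖ • Y) :
    (N + N * Y * N).map π ∈ topLayer hϖ ρ := by
  refine mem_topLayer hϖ (s := s ^ p) ?_
  rw [map_pow, hs, add_assoc, pow_lift_eq hϖ hp hN,
    natCast_smul_smul_eq_zero hϖ (by rw [hp3]; decide), hp3, Nat.choose_self, Nat.cast_one,
    one_smul, add_zero, smul_add, add_assoc]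

theorem map_mem_topLayer_of_two (hp2 : p = 2) (hp : (p : R) = ϖ) {s : H}
    {N Y : Matrix m m R} (hN : N * N = 0) (hs : ρ s = 1 + N + ϖ • Y) :
    (N + N * Y + Y * N).map π ∈ topLayer hϖ ρ := by
  refine mem_topLayer hϖ (s := s ^ p) ?_
  rw [map_pow, hs, add_assoc, pow_lift_eq hϖ hp hN, hp2, Nat.choose_self, Nat.cast_one,
    one_smul, show Nat.choose 2 3 = 0 from rfl, Nat.cast_zero, zero_smul, add_zero, add_assoc,
    add_assoc N, smul_add ϖ N]

/-- The `p`-th power of a lift of `1 + c N`, where `c = p ^ (a - 2)` and `a ≥ 3`. -/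
theorem map_mem_topLayer_of_mul_eq {c : R} (hc : c * p = ϖ) (hcc : c * c * p = 0)
    {s : H} {N Y : Matrix m m R} (hN : N * N = 0) (hs : ρ s = 1 + c • N + ϖ • Y) :
    N.map π ∈ topLayer hϖ ρ := by
  have hϖp : (p : R) * ϖ = 0 := by
    rw [mul_comm, hϖ.mul_eq_zero_iff, map_natCast, ZMod.natCast_self]
  have hcϖ : c * ϖ = 0 := by rw [← hc, ← mul_assoc, hcc]
  have hX : (c • N + ϖ • Y) ^ 2 = 0 := by
    rw [pow_two, mul_add, add_mul, add_mul, smul_mul_smul_comm, hN, smul_mul_smul_comm,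
      smul_mul_smul_comm, smul_mul_smul_comm, hϖ.mul_self, hcϖ, mul_comm ϖ c, hcϖ]
    simp
  refine mem_topLayer hϖ (s := s ^ p) ?_
  rw [map_pow, hs, add_assoc, one_add_pow_of_pow_four_eq_zero (by rw [pow_mul _ 2 2, hX]; simp),
    pow_succ _ 2, hX, natCast_mul_eq_smul rfl, smul_add, _root_.smul_smul, _root_.smul_smul, hϖp,
    mul_comm, hc]
  simp

theorem mul_lift_eq (hϖ : IsTopLayer π ϖ) {A B Y Z : Matrix m m R} (hAB : A * B = 0) :
    (1 + A + ϖ • Y) * (1 + B + ϖ • Z) = 1 + (A + B) + ϖ • (Y + Z + A * Z + Y * B) := by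
  simp only [add_mul, mul_add, one_mul, mul_one, hAB, smul_mul_assoc, mul_smul_comm, smul_add,
    hϖ.smul_smul]
  abel

end TopLayer

/-! ### The top layer of a supplement in SL -/

section TopLayerSL

variable {p : ℕ} [Fact p.Prime] {R : Type*} [CommRing R] {π : R →+* ZMod p} {ϖ : R}
  {m : Type*} [Fintype m] [DecidableEq m] {H : Type*} [Group H] {hϖ : IsTopLayer π ϖ}
  {ρ : H →* Matrix m m R}

/-- Since st = ts + ϖD, the commutator is 1 + ϖ D(ts)⁻¹. Multiplying by ts ≡ 1 + A + B avoids the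
inverse. -/
theorem exists_commutator_mem_topLayer {s t : H} {A B Y Z : Matrix m m R} (hAB : A * B = 0)
    (hBA : B * A = 0) (hs : ρ s = 1 + A + ϖ • Y) (ht : ρ t = 1 + B + ϖ • Z) :
    ∃ x ∈ topLayer hϖ ρ,
      (A * Z + Y * B - Z * A - B * Y).map π = x * (1 + A + B).map π := by
  set D := A * Z + Y * B - Z * A - B * Y with hD
  have hst : ρ (s * t) = ρ (t * s) + ϖ • D := by
    rw [map_mul, map_mul, hs, ht, mul_lift_eq hϖ hAB, mul_lift_eq hϖ hBA, hD]
    simp only [smul_add, smul_sub]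
    abel
  have h1 : ρ (t * s) * ρ (t * s)⁻¹ = 1 := by rw [← map_mul, mul_inv_cancel, map_one]
  have h2 : ρ (t * s)⁻¹ * ρ (t * s) = 1 := by rw [← map_mul, inv_mul_cancel, map_one]
  refine ⟨(D * ρ (t * s)⁻¹).map π, mem_topLayer hϖ (s := s * t * (t * s)⁻¹) ?_, ?_⟩
  · rw [map_mul, hst, add_mul, h1, smul_mul_assoc]
  · have h3 : (ρ (t * s)).map π = (1 + A + B).map π := by
      rw [map_mul, hs, ht, mul_lift_eq hϖ hBA]
      ext i j
      simp [hϖ.map_self, add_assoc, add_comm (π (A i j))]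
    rw [← h3, ← Matrix.map_mul, mul_assoc, h2, mul_one]

theorem exists_transvection_lift (hcov : ∀ g : Matrix m m R, g.det = 1 → ∃ s Y, ρ s = g + ϖ • Y)
    {i j : m} (hij : i ≠ j) (c : R) : ∃ s Y, ρ s = 1 + single i j c + ϖ • Y :=
  hcov (transvection i j c) (det_transvection_of_ne i j hij c)

theorem isTransvectionStable_topLayer
    (hcov : ∀ g : Matrix m m R, g.det = 1 → ∃ s Y, ρ s = g + ϖ • Y) :
    IsTransvectionStable (topLayer hϖ ρ) := by
  intro i j hij x hx
  refine conj_mem_topLayer hϖ ?_ ?_ hx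
  · have : single i j (1 : ZMod p) * single i j 1 = 0 := single_mul_single_of_ne _ _ _ _ hij.symm _
    rw [add_mul, one_mul, mul_sub, mul_one, this]
    abel
  · obtain ⟨s, Y, hs⟩ := exists_transvection_lift hcov hij 1
    refine ⟨s, ?_⟩
    rw [hs]
    ext k l
    simp [hϖ.map_self, single_apply, Matrix.one_apply, apply_ite π]

theorem single_mem_topLayer_of_five_le
    (hcov : ∀ g : Matrix m m R, g.det = 1 → ∃ s Y, ρ s = g + ϖ • Y) (hp5 : 5 ≤ p)
    (hp : (p : R) = ϖ) (i j : m) (hij : i ≠ j) : single i j 1 ∈ topLayer hϖ ρ := by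
  obtain ⟨s, Y, hs⟩ := exists_transvection_lift hcov hij 1
  have := map_mem_topLayer_of_five_le hϖ hp5 Fact.out hp
    (single_mul_single_of_ne _ _ _ _ hij.symm _) hs
  simpa using this

theorem single_mem_topLayer_of_mul_eq
    (hcov : ∀ g : Matrix m m R, g.det = 1 → ∃ s Y, ρ s = g + ϖ • Y)
    {c : R} (hc : c * p = ϖ) (hcc : c * c * p = 0) (i j : m) (hij : i ≠ j) :
    single i j 1 ∈ topLayer hϖ ρ := by
  obtain ⟨s, Y, hs⟩ := exists_transvection_lift hcov hij c
  rw [single_eq_smul_single_one] at hs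
  have := map_mem_topLayer_of_mul_eq hϖ hc hcc
    (single_mul_single_of_ne _ _ _ _ hij.symm _) hs
  simpa using this

theorem single_mem_topLayer_of_three
    (hcov : ∀ g : Matrix m m R, g.det = 1 → ∃ s Y, ρ s = g + ϖ • Y) (hp3 : p = 3)
    (hp : (p : R) = ϖ) (hm : 3 ≤ Fintype.card m) (u v : m) (huv : u ≠ v) :
    single u v 1 ∈ topLayer hϖ ρ := by
  have hL := isTransvectionStable_topLayer (hϖ := hϖ) hcov
  by_contra hcon
  have hzero : ∀ x ∈ topLayer hϖ ρ, ∀ i j, i ≠ j → x i j = 0 := by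
    intro x hx i j hij
    by_contra hne
    exact hcon (hL.single_mem hm
      (hL.single_mem_of_apply_ne_zero_of_odd (by omega) hij.symm hx hne) u v huv)
  obtain ⟨w, -, hw⟩ := Finset.exists_mem_notMem_of_card_lt_card
    (s := {u, v}) (t := Finset.univ)
    ((Finset.card_le_two).trans_lt (by rw [Finset.card_univ]; omega))
  simp only [Finset.mem_insert, Finset.mem_singleton, not_or] at hw
  obtain ⟨hwu, hwv⟩ := hw
  have hN : ∀ a b c d : R, (single u v a + single u w b) * (single u v c + single u w d) = 0 := by
    intro a b c d
    simp [mul_add, add_mul, huv.symm, hwu]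
  -- For N = aE_uv + bE_uw one has NYN = λN with λ = aY_vu + bY_wu, so the cube contributes (1 +
  -- λ)N, whose off-diagonal entries must vanish.
  have key : ∀ (a b : R) (s : H) (Y : Matrix m m R),
      ρ s = 1 + (single u v a + single u w b) + ϖ • Y →
      π a + (π a * π (Y v u) + π b * π (Y w u)) * π a = 0 ∧
      π b + (π a * π (Y v u) + π b * π (Y w u)) * π b = 0 := by
    intro a b s Y hs
    have h := map_mem_topLayer_of_three hϖ hp3 hp (hN a b a b) hs
    have e : (single u v a + single u w b) * Y * (single u v a + single u w b) =
        single u v ((a * Y v u + b * Y w u) * a) + single u w ((a * Y v u + b * Y w u) * b) := by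
      simp only [add_mul, mul_add, single_mul_mul_single, single_add]
    have h1 := hzero _ h u v huv
    have h2 := hzero _ h u w (Ne.symm hwu)
    rw [e] at h1 h2
    constructor
    · simpa [hwv] using h1
    · simpa [Ne.symm hwv] using h2
  -- The elements g, h, gh, ghh lift (a, b) = (1,0), (0,1), (1,1), (1,2). Along them λ is a
  -- quadratic form in (a, b), and it cannot equal -1 at all four points unless 2 = 0.
  obtain ⟨g, Y, hg⟩ := exists_transvection_lift hcov huv 1
  obtain ⟨h, Z, hh⟩ := exists_transvection_lift hcov (Ne.symm hwu) 1
  have hg' : ρ g = 1 + (single u v 1 + single u w 0) + ϖ • Y := by simp [hg]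
  have hh' : ρ h = 1 + (single u v 0 + single u w 1) + ϖ • Z := by simp [hh]
  have hgh := map_mul ρ g h
  rw [hg', hh', mul_lift_eq hϖ (hN _ _ _ _), add_add_add_comm, ← single_add, ← single_add] at hgh
  have hghh := map_mul ρ (g * h) h
  rw [hgh, hh', mul_lift_eq hϖ (hN _ _ _ _), add_add_add_comm, ← single_add, ← single_add] at hghh
  have k1 := (key _ _ _ _ hg').1
  have k2 := (key _ _ _ _ hh').2
  have k3 := (key _ _ _ _ hgh).1
  have k4 := (key _ _ _ _ hghh).1
  simp [add_mul, single_mul_apply_of_ne, mul_single_apply_of_ne, huv, huv.symm, hwu,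
    Ne.symm hwu] at k1 k2 k3 k4
  have h2 : (2 : ZMod p) = 0 := by linear_combination 2 * k3 - k4 - k1 + 2 * k2
  have h3 : ((2 : ℕ) : ZMod p) = 0 := by exact_mod_cast h2
  rw [ZMod.natCast_eq_zero_iff, hp3] at h3
  omega

theorem single_mem_topLayer_of_two
    (hcov : ∀ g : Matrix m m R, g.det = 1 → ∃ s Y, ρ s = g + ϖ • Y) (hp2 : p = 2)
    (hp : (p : R) = ϖ) (e : Fin 5 ↪ m) (u v : m) (huv : u ≠ v) :
    single u v 1 ∈ topLayer hϖ ρ := by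
  have hL := isTransvectionStable_topLayer (hϖ := hϖ) hcov
  have hm : 4 ≤ Fintype.card m := by
    have := Fintype.card_le_of_embedding e
    simp only [Fintype.card_fin] at this
    omega
  refine (hL.isScalar_or_single_mem hm).elim (fun hsc => ?_) fun h => h u v huv
  exfalso
  have hcomm : ∀ i j k l q : m, j ≠ k → l ≠ i → q ≠ i → q ≠ j → q ≠ k → q ≠ l →
      ∀ (s t : H) (Y Z : Matrix m m R), ρ s = 1 + single i j 1 + ϖ • Y → ρ t = 1 + single k l 1 + ϖ • Z →
      (single i j 1 * Z + Y * single k l 1 - Z * single i j 1 - single k l 1 * Y).map π = 0 := by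
    intro i j k l q hjk hli hqi hqj hqk hql s t Y Z hs ht
    obtain ⟨x, hx, hxe⟩ := exists_commutator_mem_topLayer (hϖ := hϖ)
      (single_mul_single_of_ne _ _ _ _ hjk _) (single_mul_single_of_ne _ _ _ _ hli _) hs ht
    -- At an index q outside i, j, k, l the commutator term has diagonal entry 0 and 1 + A + B has
    -- entry 1, so the scalar x is 0. Four distinct indices i, j, k, l call for a fifth.
    have hx0 : x q q = 0 := by
      have hmul : ∀ M : Matrix m m (ZMod p), (x * M) q q = x q q * M q q := fun M => by
        rw [mul_apply, Finset.sum_eq_single q]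
        · intro b _ hb
          rw [(hsc x hx q b hb.symm).1, zero_mul]
        · simp
      have := congrFun (congrFun hxe q) q
      rw [hmul] at this
      simpa [single_mul_apply_of_ne, mul_single_apply_of_ne, hqi, hqj, hqk, hql,
        single_apply_of_row_ne hqi.symm, single_apply_of_row_ne hqk.symm] using this.symm
    have hx00 : x = 0 := by
      ext i j
      by_cases hij : i = j
      · rw [← hij]
        by_cases hiq : i = q
        · rw [hiq, hx0]
          rfl
        · rw [(hsc x hx i q hiq).2, hx0]
          rfl
      · exact (hsc x hx i j hij).1
    rw [hxe, hx00, zero_mul]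
  have ne : ∀ a b : Fin 5, a ≠ b → e a ≠ e b := fun a b hab h => hab (e.injective h)
  have lift : ∀ a b : Fin 5, a ≠ b → ∃ s Y, ρ s = 1 + single (e a) (e b) 1 + ϖ • Y :=
    fun a b hab => exists_transvection_lift hcov (ne a b hab) 1
  obtain ⟨g1, Y1, hg1⟩ := lift 0 1 (by decide)
  obtain ⟨g2, Y2, hg2⟩ := lift 0 2 (by decide)
  obtain ⟨g4, Y4, hg4⟩ := lift 0 4 (by decide)
  obtain ⟨l, W, hl⟩ := lift 1 2 (by decide)
  obtain ⟨l', W', hl'⟩ := lift 3 2 (by decide)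
  have comm : ∀ a b c d q : Fin 5, b ≠ c → d ≠ a → q ≠ a → q ≠ b → q ≠ c → q ≠ d →
      ∀ (s t : H) (Y Z : Matrix m m R), ρ s = 1 + single (e a) (e b) 1 + ϖ • Y →
      ρ t = 1 + single (e c) (e d) 1 + ϖ • Z → ∀ x y,
      π ((single (e a) (e b) 1 * Z + Y * single (e c) (e d) 1 - Z * single (e a) (e b) 1 -
        single (e c) (e d) 1 * Y : Matrix m m R) (e x) (e y)) = 0 :=
    fun a b c d q h1 h2 h3 h4 h5 h6 s t Y Z hs ht x y => congrFun (congrFun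
      (hcomm _ _ _ _ _ (ne _ _ h1) (ne _ _ h2) (ne _ _ h3) (ne _ _ h4) (ne _ _ h5) (ne _ _ h6)
        s t Y Z hs ht) (e x)) (e y)
  -- Modulo 2, c1, c2 and the square c6 give Y1_21 + W_10 = 1, whereas c3, c4, c5 give W_10 = Y4_24
  -- = W'_30 = Y1_21.
  have c1 := comm 0 1 0 2 3 (by decide) (by decide) (by decide) (by decide) (by decide) (by decide)
    _ _ _ _ hg1 hg2 0 1
  have c2 := comm 1 2 0 2 3 (by decide) (by decide) (by decide) (by decide) (by decide) (by decide)
    _ _ _ _ hl hg2 1 2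
  have c3 := comm 1 2 0 4 3 (by decide) (by decide) (by decide) (by decide) (by decide) (by decide)
    _ _ _ _ hl hg4 1 4
  have c4 := comm 3 2 0 4 1 (by decide) (by decide) (by decide) (by decide) (by decide) (by decide)
    _ _ _ _ hl' hg4 3 4
  have c5 := comm 3 2 0 1 4 (by decide) (by decide) (by decide) (by decide) (by decide) (by decide)
    _ _ _ _ hl' hg1 3 1
  have c6 := (hsc _ (map_mem_topLayer_of_two hϖ hp2 hp
    (single_mul_single_of_ne _ _ _ _ (ne _ _ (by decide)) _) hg2) (e 0) (e 2)
    (ne _ _ (by decide))).1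
  simp [single_mul_apply_of_ne, mul_single_apply_of_ne] at c1 c2 c3 c4 c5 c6
  have h2 : (2 : ZMod p) = 0 := by
    subst hp2
    rfl
  refine one_ne_zero (α := ZMod p) ?_
  linear_combination c6 + c1 - c2 + c5 - c4 + c3 - π (Y2 (e 1) (e 1)) * h2

end TopLayerSL

/-! ### Matrix groups stable under symplectic congruence -/

section SymplecticModule

variable {l : Type*} [Fintype l] [DecidableEq l]

/-- The standard symplectic form `vᵀ J w`. -/
def symplecticForm {R : Type*} [CommRing R] (v w : l ⊕ l → R) : R := v ⬝ᵥ J l R *ᵥ w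

section Form

variable {R : Type*} [CommRing R]

theorem symplecticForm_eq_sum (v w : l ⊕ l → R) :
    symplecticForm v w = ∑ i, (v (.inr i) * w (.inl i) - v (.inl i) * w (.inr i)) := by
  simp [symplecticForm, J, dotProduct, mulVec, Fintype.sum_sum_type, fromBlocks,
    Matrix.one_apply, sub_eq_neg_add, Finset.sum_add_distrib]

theorem symplecticForm_self (v : l ⊕ l → R) : symplecticForm v v = 0 := by
  rw [symplecticForm_eq_sum]
  exact Finset.sum_eq_zero fun i _ => by ring

theorem symplecticForm_swap (v w : l ⊕ l → R) : symplecticForm v w = -symplecticForm w v := by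
  rw [symplecticForm_eq_sum, symplecticForm_eq_sum, ← Finset.sum_neg_distrib]
  exact Finset.sum_congr rfl fun i _ => by ring

theorem symplecticForm_add_left (u v w : l ⊕ l → R) :
    symplecticForm (u + v) w = symplecticForm u w + symplecticForm v w :=
  add_dotProduct _ _ _

theorem symplecticForm_add_right (u v w : l ⊕ l → R) :
    symplecticForm u (v + w) = symplecticForm u v + symplecticForm u w := by
  rw [symplecticForm, mulVec_add, dotProduct_add]
  rfl

theorem symplecticForm_smul_left (c : R) (v w : l ⊕ l → R) :
    symplecticForm (c • v) w = c * symplecticForm v w :=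
  smul_dotProduct _ _ _

theorem symplecticForm_smul_right (c : R) (v w : l ⊕ l → R) :
    symplecticForm v (c • w) = c * symplecticForm v w := by
  rw [symplecticForm, mulVec_smul, dotProduct_smul]
  rfl

theorem symplecticForm_single_left_sq (b : l ⊕ l) (w : l ⊕ l → R) :
    symplecticForm (Pi.single b 1) w = w b.swap ∨ symplecticForm (Pi.single b 1) w = -w b.swap := by
  rw [symplecticForm_eq_sum]
  rcases b with i | i
  · right
    simp [Pi.single_apply]
  · left
    simp [Pi.single_apply]

/-- The nilpotent matrix `v vᵀ J`; the symplectic transvection along `v` is `1 + v vᵀ J`. -/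
def symplecticNilpotent (v : l ⊕ l → R) : Matrix (l ⊕ l) (l ⊕ l) R := vecMulVec v v * J l R

theorem symplecticNilpotent_mulVec (v w : l ⊕ l → R) :
    symplecticNilpotent v *ᵥ w = symplecticForm v w • v := by
  rw [symplecticNilpotent, ← mulVec_mulVec, vecMulVec_mulVec]
  ext i
  simp [symplecticForm, mul_comm]

theorem transvection_conj_vecMulVec (u x y : l ⊕ l → R) :
    (1 + symplecticNilpotent u) * vecMulVec x y * (1 + symplecticNilpotent u)ᵀ =
      vecMulVec (x + symplecticForm u x • u) (y + symplecticForm u y • u) := by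
  rw [mul_vecMulVec, vecMulVec_mul, vecMul_transpose, add_mulVec, add_mulVec, one_mulVec,
    one_mulVec, symplecticNilpotent_mulVec, symplecticNilpotent_mulVec]

theorem J_mul_mul_J_transpose_apply (b : l ⊕ l) (x : Matrix (l ⊕ l) (l ⊕ l) R) :
    (J l R * x * (J l R)ᵀ) b b = x b.swap b.swap := by
  rcases b with i | i <;>
    simp [J, mul_apply, Fintype.sum_sum_type, fromBlocks, Matrix.one_apply]

theorem symplecticNilpotent_single_conj (b : l ⊕ l) (x : Matrix (l ⊕ l) (l ⊕ l) R) :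
    symplecticNilpotent (Pi.single b 1) * x * (symplecticNilpotent (Pi.single b 1))ᵀ =
      x b.swap b.swap • vecMulVec (Pi.single b 1) (Pi.single b 1) := by
  rw [symplecticNilpotent, transpose_mul, ← single_eq_single_vecMulVec_single, transpose_single]
  have : single b b 1 * J l R * x * ((J l R)ᵀ * single b b 1) =
      single b b 1 * (J l R * x * (J l R)ᵀ) * single b b 1 := by
    simp only [mul_assoc]
  rw [this, single_mul_mul_single, J_mul_mul_J_transpose_apply, one_mul, mul_one, single_eq_smul_single_one]

theorem vecMulVec_mul_J_mul_vecMulVec (v : l ⊕ l → R) :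
    vecMulVec v v * J l R * vecMulVec v v = 0 := by
  rw [mul_assoc, mul_vecMulVec, vecMulVec_mul_vecMulVec]
  have := symplecticForm_self v
  rw [symplecticForm] at this
  rw [this, zero_smul, vecMulVec_zero]

theorem symplecticNilpotent_mul_self (v : l ⊕ l → R) :
    symplecticNilpotent v * symplecticNilpotent v = 0 := by
  rw [symplecticNilpotent, ← mul_assoc, vecMulVec_mul_J_mul_vecMulVec, zero_mul]

theorem transvection_conj_add (u : l ⊕ l → R) (x y : Matrix (l ⊕ l) (l ⊕ l) R) :
    (1 + symplecticNilpotent u) * (x + y) * (1 + symplecticNilpotent u)ᵀ =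
      (1 + symplecticNilpotent u) * x * (1 + symplecticNilpotent u)ᵀ +
        (1 + symplecticNilpotent u) * y * (1 + symplecticNilpotent u)ᵀ := by
  rw [mul_add, add_mul]

end Form

variable {p : ℕ} [Fact p.Prime]

/-- Additive groups of matrices stable under congruence by the symplectic transvections. -/
def IsSymplecticStable (M : AddSubgroup (Matrix (l ⊕ l) (l ⊕ l) (ZMod p))) : Prop :=
  ∀ v, ∀ x ∈ M, (1 + symplecticNilpotent v) * x * (1 + symplecticNilpotent v)ᵀ ∈ M

variable {M : AddSubgroup (Matrix (l ⊕ l) (l ⊕ l) (ZMod p))}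

/-- The transvection along w followed by the one along v sends v to -cw with c = ±1, and vvᵀ does
not see the sign. -/
theorem IsSymplecticStable.rankOne_mem (hM : IsSymplecticStable M) {v w : l ⊕ l → ZMod p}
    (hvw : symplecticForm v w = 1 ∨ symplecticForm v w = -1) (hv : vecMulVec v v ∈ M) :
    vecMulVec w w ∈ M := by
  set c := symplecticForm v w with hc
  have hcc : c * c = 1 := by rcases hvw with h | h <;> rw [h] <;> ring
  have h1 := hM v _ (hM w _ hv)
  have e : v + symplecticForm w v • w + symplecticForm v (v + symplecticForm w v • w) • v =
      -(c • w) := by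
    rw [symplecticForm_add_right, symplecticForm_smul_right, symplecticForm_self,
      symplecticForm_swap w v, ← hc, zero_add, neg_mul, hcc]
    module
  rw [transvection_conj_vecMulVec, transvection_conj_vecMulVec, e] at h1
  convert h1 using 1
  ext i j
  simp only [vecMulVec_apply, Pi.neg_apply, Pi.smul_apply, smul_eq_mul]
  linear_combination (-(w i * w j)) * hcc

theorem IsSymplecticStable.rankOne_mem_of_single (hM : IsSymplecticStable M) {b : l ⊕ l}
    {w : l ⊕ l → ZMod p} (hw : w b.swap = 1)
    (hb : vecMulVec (Pi.single b 1) (Pi.single b 1) ∈ M) : vecMulVec w w ∈ M := by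
  refine hM.rankOne_mem ?_ hb
  have := symplecticForm_single_left_sq b w
  rwa [hw] at this

theorem IsSymplecticStable.single_mem_of_rankOne (hM : IsSymplecticStable M) {b : l ⊕ l}
    {w : l ⊕ l → ZMod p} (hw : w b.swap = 1) (h : vecMulVec w w ∈ M) :
    vecMulVec (Pi.single b 1) (Pi.single b 1) ∈ M := by
  refine hM.rankOne_mem ?_ h
  rw [symplecticForm_swap]
  obtain h | h := symplecticForm_single_left_sq b w
  · simp [h, hw]
  · simp [h, hw]

theorem IsSymplecticStable.symm_mem_of_rankOne
    (h1 : ∀ b : l ⊕ l, vecMulVec (Pi.single b 1) (Pi.single b 1) ∈ M)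
    (h2 : ∀ b c : l ⊕ l, b ≠ c →
      vecMulVec (Pi.single b 1 + Pi.single c 1) (Pi.single b 1 + Pi.single c 1) ∈ M)
    {x : Matrix (l ⊕ l) (l ⊕ l) (ZMod p)} (hx : xᵀ = x) : x ∈ M := by
  have hd : ∀ b c, single b b c ∈ M := fun b c => by
    rw [single_eq_smul_single_one, single_eq_single_vecMulVec_single]
    exact M.zmod_smul_mem c (h1 b)
  have ho : ∀ b c, b ≠ c → ∀ r, single b c r + single c b r ∈ M := fun b c hbc r => by
    rw [single_eq_smul_single_one, single_eq_smul_single_one c, ← smul_add]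
    refine M.zmod_smul_mem r ?_
    have := sub_mem (sub_mem (h2 b c hbc) (h1 b)) (h1 c)
    convert this using 1
    rw [single_eq_single_vecMulVec_single, single_eq_single_vecMulVec_single, add_vecMulVec,
      vecMulVec_add, vecMulVec_add]
    abel
  -- An arbitrary ordering of the indices, so that each off-diagonal pair is counted once.
  let e := Fintype.equivFin (l ⊕ l)
  have hsplit : x = ∑ i, ∑ j, ((if e i < e j then single i j (x i j) + single j i (x i j) else 0) +
      if i = j then single i j (x i j) else 0) := by
    have hswap : ∑ i, ∑ j, (if e i < e j then single j i (x i j) else 0) =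
        ∑ i, ∑ j, if e j < e i then single i j (x i j) else 0 := by
      rw [Finset.sum_comm]
      refine Finset.sum_congr rfl fun i _ => Finset.sum_congr rfl fun j _ => ?_
      rw [← congrFun (congrFun hx i) j]
      rfl
    have hite : ∀ i j, (if e i < e j then single i j (x i j) + single j i (x i j) else 0) =
        (if e i < e j then single i j (x i j) else 0) +
          if e i < e j then single j i (x i j) else 0 := fun i j => by
      split_ifs <;> simp
    simp only [hite, Finset.sum_add_distrib]
    rw [hswap]
    simp only [← Finset.sum_add_distrib]
    conv_lhs => rw [matrix_eq_sum_single x]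
    refine Finset.sum_congr rfl fun i _ => Finset.sum_congr rfl fun j _ => ?_
    rcases lt_trichotomy (e i) (e j) with h | h | h
    · have : i ≠ j := fun h' => by simp [h'] at h
      simp [h, h.not_gt, this]
    · simp [e.injective h]
    · have : i ≠ j := fun h' => by simp [h'] at h
      simp [h, h.not_gt, this]
  rw [hsplit]
  refine sum_mem fun i _ => sum_mem fun j _ => add_mem ?_ ?_
  · split_ifs with h
    · exact ho i j (fun h' => by simp [h'] at h) _
    · exact zero_mem _
  · split_ifs with h
    · rw [h]
      exact hd j _
    · exact zero_mem _

/-- Two basis vectors are linked through the sum of their dual basis vectors, which pairs to ±1 with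
both. -/
theorem IsSymplecticStable.symm_mem_of_single (hM : IsSymplecticStable M) {b : l ⊕ l}
    (hb : vecMulVec (Pi.single b 1) (Pi.single b 1) ∈ M)
    {x : Matrix (l ⊕ l) (l ⊕ l) (ZMod p)} (hx : xᵀ = x) : x ∈ M := by
  have h1 : ∀ c : l ⊕ l, vecMulVec (Pi.single c 1) (Pi.single c 1) ∈ M := by
    intro c
    by_cases hbc : c = b
    · rwa [hbc]
    · have hne : c.swap ≠ b.swap := fun h => hbc (by rw [← c.swap_swap, h, b.swap_swap])
      refine hM.single_mem_of_rankOne (w := Pi.single b.swap 1 + Pi.single c.swap 1) ?_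
        (hM.rankOne_mem_of_single ?_ hb)
      · simp [hne]
      · simp [hne.symm]
  refine symm_mem_of_rankOne h1 (fun c d hcd => ?_) hx
  refine hM.rankOne_mem_of_single (b := c.swap) ?_ (h1 _)
  simp [hcd]

/-- The second difference of x under the transvection along e_b is 2NxNᵀ, a nonzero multiple of e_b
e_bᵀ. -/
theorem IsSymplecticStable.single_mem_of_odd (hM : IsSymplecticStable M) (hp : p ≠ 2) {b : l ⊕ l}
    {x : Matrix (l ⊕ l) (l ⊕ l) (ZMod p)} (hx : x ∈ M) (hxb : x b.swap b.swap ≠ 0) :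
    vecMulVec (Pi.single b 1) (Pi.single b 1) ∈ M := by
  set N : Matrix (l ⊕ l) (l ⊕ l) (ZMod p) := symplecticNilpotent (Pi.single b 1) with hN
  have hNN : N * N = 0 := symplecticNilpotent_mul_self _
  have h1 := hM (Pi.single b 1) x hx
  have h2 := hM (Pi.single b 1) _ h1
  rw [← hN] at h1 h2
  have h3 := add_mem (sub_mem (sub_mem h2 h1) h1) hx
  have e : (1 + N) * ((1 + N) * x * (1 + N)ᵀ) * (1 + N)ᵀ - (1 + N) * x * (1 + N)ᵀ -
      (1 + N) * x * (1 + N)ᵀ + x = (2 : ZMod p) • (N * x * Nᵀ) := by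
    have e1 : (1 + N) * (1 + N) = 1 + N + N := by
      rw [mul_add, add_mul, add_mul, hNN]
      simp [add_assoc]
    have e2 : (1 + N)ᵀ * (1 + N)ᵀ = 1 + Nᵀ + Nᵀ := by
      rw [← transpose_mul, e1]
      simp
    have e3 : (1 + N) * ((1 + N) * x * (1 + N)ᵀ) * (1 + N)ᵀ =
        (1 + N + N) * x * (1 + Nᵀ + Nᵀ) := by
      rw [← e1, ← e2]
      simp only [mul_assoc]
    rw [e3, transpose_add, transpose_one, two_smul]
    noncomm_ring
  rw [e, hN, symplecticNilpotent_single_conj, smul_smul] at h3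
  refine M.mem_of_zmod_smul_mem (mul_ne_zero ?_ hxb) h3
  intro h2
  have h3 : ((2 : ℕ) : ZMod p) = 0 := by exact_mod_cast h2
  rw [ZMod.natCast_eq_zero_iff] at h3
  exact hp ((Nat.prime_dvd_prime_iff_eq Fact.out Nat.prime_two).1 h3)

section CharTwo

variable {M : AddSubgroup (Matrix (l ⊕ l) (l ⊕ l) (ZMod 2))}

/-- With v = e_b and a = xJᵀv, the first difference Nx + xNᵀ + NxNᵀ is the required matrix, and the
form of v and a is the given diagonal entry of x. -/
theorem IsSymplecticStable.exists_hyperbolic_mem (hM : IsSymplecticStable M) {b : l ⊕ l}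
    {x : Matrix (l ⊕ l) (l ⊕ l) (ZMod 2)} (hx : x ∈ M) (hxs : xᵀ = x)
    (hxb : x b.swap b.swap = 1) : ∃ a, symplecticForm (Pi.single b 1) a = 1 ∧
      vecMulVec (Pi.single b 1) a + vecMulVec a (Pi.single b 1) +
        vecMulVec (Pi.single b 1) (Pi.single b 1) ∈ M := by
  set v : l ⊕ l → ZMod 2 := Pi.single b 1 with hv
  have hconj := symplecticNilpotent_single_conj b x
  rw [hxb, one_smul, ← hv] at hconj
  have h1 := sub_mem (hM v x hx) hx
  have ea : symplecticNilpotent v * x = vecMulVec v (x *ᵥ ((J l (ZMod 2))ᵀ *ᵥ v)) := by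
    rw [symplecticNilpotent, mul_assoc, vecMulVec_mul, mulVec_mulVec, ← vecMul_transpose,
      transpose_mul, transpose_transpose, hxs]
  have ea' : x * (symplecticNilpotent v)ᵀ = vecMulVec (x *ᵥ ((J l (ZMod 2))ᵀ *ᵥ v)) v := by
    have := congrArg transpose ea
    rwa [transpose_mul, hxs, transpose_vecMulVec] at this
  refine ⟨x *ᵥ ((J l (ZMod 2))ᵀ *ᵥ v), ?_, ?_⟩
  · rw [← hxb, ← J_mul_mul_J_transpose_apply b x, symplecticForm, mulVec_mulVec, mulVec_mulVec,
      hv, mulVec_single_one, single_one_dotProduct]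
    rfl
  · rw [← ea, ← ea', ← hconj]
    convert h1 using 1
    rw [transpose_add, transpose_one]
    noncomm_ring

/-- The index c lies outside the hyperbolic pair of b, and e_c is corrected to w orthogonal to v and
a. Transvections along a, a + w and w + v turn vaᵀ + avᵀ + vvᵀ into elements whose differences give
vwᵀ + wvᵀ and vwᵀ + wvᵀ + wwᵀ, hence wwᵀ. -/
theorem IsSymplecticStable.exists_single_mem_of_two (hM : IsSymplecticStable M) {b c : l ⊕ l}
    (hcb : c ≠ b) (hcb' : c ≠ b.swap)
    {x : Matrix (l ⊕ l) (l ⊕ l) (ZMod 2)} (hx : x ∈ M) (hxs : xᵀ = x)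
    (hxb : x b.swap b.swap = 1) :
    vecMulVec (Pi.single c.swap 1) (Pi.single c.swap 1) ∈ M := by
  have h2 : (2 : ZMod 2) = 0 := rfl
  have hneg : ∀ z : ZMod 2, -z = z := by decide
  obtain ⟨a, hva, hW⟩ := hM.exists_hyperbolic_mem hx hxs hxb
  set v : l ⊕ l → ZMod 2 := Pi.single b 1 with hv
  have hav : symplecticForm a v = 1 := by rw [symplecticForm_swap, hva, hneg]
  set w : l ⊕ l → ZMod 2 := Pi.single c 1 + symplecticForm (Pi.single c 1) a • v with hw
  have hcv : symplecticForm (Pi.single c 1) v = 0 := by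
    have : v c.swap = 0 := by
      rw [hv, Pi.single_apply, if_neg]
      intro h
      exact hcb' (by rw [← h, c.swap_swap])
    obtain h | h := symplecticForm_single_left_sq c v
    · rw [h, this]
    · rw [h, this, neg_zero]
  have hwv : symplecticForm w v = 0 := by
    rw [hw, symplecticForm_add_left, symplecticForm_smul_left, symplecticForm_self, hcv]
    simp
  have hwa : symplecticForm w a = 0 := by
    rw [hw, symplecticForm_add_left, symplecticForm_smul_left, hva]
    linear_combination symplecticForm (Pi.single c 1) a * h2
  have haw : symplecticForm a w = 0 := by rw [symplecticForm_swap, hwa, neg_zero]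
  have hva' : vecMulVec v v + vecMulVec a a ∈ M := by
    have h := hM a _ hW
    simp only [transvection_conj_add, transvection_conj_vecMulVec, symplecticForm_self, hav, zero_smul,
      one_smul, add_zero] at h
    convert h using 1
    ext i j
    simp only [Matrix.add_apply, vecMulVec_apply, Pi.add_apply]
    linear_combination (-(v i * a j + a i * v j + a i * a j)) * h2
  have hvwa : vecMulVec (v + w) (v + w) + vecMulVec a a ∈ M := by
    have h := hM a _ (hM (a + w) _ hva')
    simp only [transvection_conj_add, transvection_conj_vecMulVec, symplecticForm_add_left,
      symplecticForm_add_right, symplecticForm_self, hav, hwv, hwa, haw, zero_smul,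
      one_smul, add_zero] at h
    convert h using 1
    ext i j
    simp only [Matrix.add_apply, vecMulVec_apply, Pi.add_apply]
    linear_combination (-(a i * (v j + w j) + a j * (v i + w i) + 2 * a i * a j)) * h2
  have hvw : vecMulVec v w + vecMulVec w v ∈ M := by
    have h := sub_mem (hM (w + v) _ hW) hW
    simp only [transvection_conj_add, transvection_conj_vecMulVec, symplecticForm_add_left,
      symplecticForm_self, hva, hwv, hwa, zero_smul, zero_add,
      one_smul, add_zero] at h
    convert h using 1
    ext i j
    simp only [Matrix.add_apply, Matrix.sub_apply, vecMulVec_apply, Pi.add_apply]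
    linear_combination (-(v i * v j)) * h2
  have hww : vecMulVec w w ∈ M := by
    have h := sub_mem (sub_mem hvwa hva') hvw
    convert h using 1
    ext i j
    simp only [Matrix.add_apply, Matrix.sub_apply, vecMulVec_apply, Pi.add_apply]
    ring
  refine hM.single_mem_of_rankOne (b := c.swap) ?_ hww
  simp [hw, hv, hcb]

end CharTwo

end SymplecticModule

/-! ### The top layer of a supplement in Sp -/

theorem map_vecMulVec_self {m R S : Type*} [CommRing R] [CommRing S] (f : R →+* S) (V : m → R) :
    (vecMulVec V V).map f = vecMulVec (fun i => f (V i)) fun i => f (V i) := by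
  ext
  simp [vecMulVec_apply]

theorem zmod_two_eq_one {z : ZMod 2} (hz : z ≠ 0) : z = 1 := by
  revert z
  decide

section TopLayerSp

variable {l : Type*} [Fintype l] [DecidableEq l] {p : ℕ} [Fact p.Prime] {R : Type*} [CommRing R]
  {π : R →+* ZMod p} {ϖ : R} {H : Type*} [Group H]

theorem J_mul_J {R : Type*} [CommRing R] : J l R * J l R = -1 := J_squared l R

theorem J_mul_J_transpose {R : Type*} [CommRing R] : J l R * (J l R)ᵀ = 1 := by
  rw [J_transpose, mul_neg, J_mul_J, neg_neg]

theorem one_add_mul_J_mem_symplecticGroup {R : Type*} [CommRing R]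
    {A : Matrix (l ⊕ l) (l ⊕ l) R} (hA : Aᵀ = A) (hAA : A * J l R * A = 0) :
    1 + A * J l R ∈ symplecticGroup l R := by
  rw [SymplecticGroup.mem_iff, transpose_add, transpose_one, transpose_mul, hA, J_transpose]
  have e : (1 + A * J l R) * J l R * (1 + -J l R * A) =
      J l R + A * (J l R * J l R) - J l R * J l R * A - A * (J l R * J l R) * J l R * A := by
    noncomm_ring
  rw [e, J_mul_J, mul_neg, mul_one, neg_mul, neg_mul, neg_mul, one_mul, hAA]
  simp

/-- The symmetric matrices `x` for which `x J` lies in the top layer. -/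
def symplecticLayer (hϖ : IsTopLayer π ϖ) (ρ : H →* Matrix (l ⊕ l) (l ⊕ l) R) :
    AddSubgroup (Matrix (l ⊕ l) (l ⊕ l) (ZMod p)) :=
  (topLayer hϖ ρ).comap (AddMonoidHom.mulRight (J l (ZMod p)))

variable {hϖ : IsTopLayer π ϖ} {ρ : H →* Matrix (l ⊕ l) (l ⊕ l) R}

theorem mem_symplecticLayer {x : Matrix (l ⊕ l) (l ⊕ l) (ZMod p)} :
    x ∈ symplecticLayer hϖ ρ ↔ x * J l (ZMod p) ∈ topLayer hϖ ρ := Iff.rfl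

theorem map_mul_J (X : Matrix (l ⊕ l) (l ⊕ l) R) :
    (X * J l R).map π = X.map π * J l (ZMod p) := by
  rw [Matrix.map_mul, map_J]

/-- The linearized symplectic condition on a lift of `1 + A J`. -/
theorem symplectic_lift_condition (hϖ : IsTopLayer π ϖ) {A Y : Matrix (l ⊕ l) (l ⊕ l) R}
    (hA : Aᵀ = A) (hAA : A * J l R * A = 0)
    (h : 1 + A * J l R + ϖ • Y ∈ symplecticGroup l R) :
    (Y * J l R + Y * A + J l R * Yᵀ - A * Yᵀ).map π = 0 := by
  have h0 := (SymplecticGroup.mem_iff).1 (one_add_mul_J_mem_symplecticGroup hA hAA)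
  rw [SymplecticGroup.mem_iff, transpose_add, add_mul, add_mul, mul_add, mul_add, h0,
    transpose_smul, smul_mul_assoc, smul_mul_smul_comm, hϖ.mul_self, zero_smul, add_zero,
    add_assoc, add_eq_left, mul_smul_comm, smul_mul_assoc, ← smul_add] at h
  have e : (1 + A * J l R) * J l R * Yᵀ + Y * J l R * (1 + A * J l R)ᵀ =
      Y * J l R + Y * A + J l R * Yᵀ - A * Yᵀ := by
    rw [transpose_add, transpose_one, transpose_mul, hA, mul_add, mul_one, add_mul, one_mul,
      mul_assoc A, J_mul_J, add_mul, mul_assoc Y, ← mul_assoc (J l R), J_mul_J_transpose]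
    simp only [mul_neg, mul_one, neg_mul, one_mul]
    abel
  rw [e] at h
  have := hϖ.smul_eq_smul_iff.1 (h.trans (smul_zero ϖ).symm)
  rw [this]
  ext
  simp

theorem transpose_eq_of_mem_symplecticLayer (hsp : ∀ s, ρ s ∈ symplecticGroup l R)
    {x : Matrix (l ⊕ l) (l ⊕ l) (ZMod p)} (hx : x ∈ symplecticLayer hϖ ρ) : xᵀ = x := by
  obtain ⟨s, X, hs, hX⟩ := hx
  have h := hsp s
  rw [hs] at h
  have h1 := symplectic_lift_condition hϖ (A := 0) (Y := X) (by simp) (by simp) (by simpa using h)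
  have h2 : x = -(X * J l R).map π := by
    rw [map_mul_J, hX]
    change x = -(x * J l (ZMod p) * J l (ZMod p))
    rw [mul_assoc, J_mul_J]
    simp
  have h3 : xᵀ = (J l R * Xᵀ).map π := by
    rw [h2, transpose_neg, ← transpose_map, transpose_mul, J_transpose]
    ext
    simp
  rw [h3, h2]
  ext i j
  have := congrFun (congrFun h1 i) j
  simp only [mul_zero, zero_mul, add_zero, sub_zero, Matrix.map_apply, Matrix.add_apply,
    map_add, Matrix.zero_apply] at this
  rw [Matrix.neg_apply, Matrix.map_apply, Matrix.map_apply]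
  linear_combination this

variable (hcov : ∀ g ∈ symplecticGroup l R, ∃ s Y, ρ s = g + ϖ • Y)
include hcov

theorem exists_symplectic_lift {A : Matrix (l ⊕ l) (l ⊕ l) R} (hA : Aᵀ = A)
    (hAA : A * J l R * A = 0) : ∃ s Y, ρ s = 1 + A * J l R + ϖ • Y :=
  hcov _ (one_add_mul_J_mem_symplecticGroup hA hAA)

theorem isSymplecticStable_symplecticLayer : IsSymplecticStable (symplecticLayer hϖ ρ) := by
  intro v x hx
  obtain ⟨V, rfl⟩ : ∃ V : l ⊕ l → R, (fun i => π (V i)) = v :=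
    ⟨fun i => (hϖ.surjective (v i)).choose, funext fun i => (hϖ.surjective (v i)).choose_spec⟩
  obtain ⟨s, Y, hs⟩ := exists_symplectic_lift hcov (transpose_vecMulVec V V)
    (vecMulVec_mul_J_mul_vecMulVec V)
  set N : Matrix (l ⊕ l) (l ⊕ l) (ZMod p) := symplecticNilpotent fun i => π (V i) with hN
  have hNN : N * N = 0 := symplecticNilpotent_mul_self _
  have h1 : (1 + N)ᵀ * J l (ZMod p) = J l (ZMod p) * (1 - N) := by
    rw [transpose_add, transpose_one, hN, symplecticNilpotent, transpose_mul, transpose_vecMulVec,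
      J_transpose]
    noncomm_ring
  rw [mem_symplecticLayer, mul_assoc, h1, ← mul_assoc, mul_assoc (1 + N)]
  refine conj_mem_topLayer hϖ ?_ ⟨s, ?_⟩ hx
  · rw [add_mul, mul_sub, mul_sub, hNN]
    simp
  · rw [hs, hN, symplecticNilpotent]
    ext i j
    rw [Matrix.map_apply, Matrix.add_apply, Matrix.add_apply, map_add, map_add, Matrix.add_apply,
      Matrix.smul_apply, smul_eq_mul, map_mul, hϖ.map_self, zero_mul, add_zero]
    congr 1
    · simp [Matrix.one_apply, apply_ite π]
    · rw [← Matrix.map_apply (f := π) (M := vecMulVec V V * J l R), map_mul_J]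
      rw [map_vecMulVec_self]

theorem symm_mem_symplecticLayer_of_rankOne
    (h : ∀ V : l ⊕ l → R, (vecMulVec V V * J l R).map π ∈ topLayer hϖ ρ)
    {x : Matrix (l ⊕ l) (l ⊕ l) (ZMod p)} (hx : xᵀ = x) : x ∈ symplecticLayer hϖ ρ := by
  rcases isEmpty_or_nonempty (l ⊕ l) with he | ⟨⟨b⟩⟩
  · rw [Subsingleton.elim x 0]
    exact zero_mem _
  · refine (isSymplecticStable_symplecticLayer hcov).symm_mem_of_single (b := b) ?_ hx
    have h1 := h (Pi.single b 1)
    rw [map_mul_J, map_vecMulVec_self] at h1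
    rw [mem_symplecticLayer]
    convert h1 using 4 <;> simp [Pi.single_apply, apply_ite π]

theorem symm_mem_symplecticLayer_of_five_le (hp5 : 5 ≤ p) (hp : (p : R) = ϖ)
    {x : Matrix (l ⊕ l) (l ⊕ l) (ZMod p)} (hx : xᵀ = x) : x ∈ symplecticLayer hϖ ρ := by
  refine symm_mem_symplecticLayer_of_rankOne hcov (fun V => ?_) hx
  obtain ⟨s, Y, hs⟩ := exists_symplectic_lift hcov (transpose_vecMulVec V V)
    (vecMulVec_mul_J_mul_vecMulVec V)
  exact map_mem_topLayer_of_five_le hϖ hp5 Fact.out hp (symplecticNilpotent_mul_self V) hs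

theorem symm_mem_symplecticLayer_of_mul_eq {c : R} (hc : c * p = ϖ) (hcc : c * c * p = 0)
    {x : Matrix (l ⊕ l) (l ⊕ l) (ZMod p)} (hx : xᵀ = x) : x ∈ symplecticLayer hϖ ρ := by
  refine symm_mem_symplecticLayer_of_rankOne hcov (fun V => ?_) hx
  obtain ⟨s, Y, hs⟩ := exists_symplectic_lift hcov (A := c • vecMulVec V V)
    (by rw [transpose_smul, transpose_vecMulVec])
    (by rw [smul_mul_assoc, smul_mul_smul_comm, vecMulVec_mul_J_mul_vecMulVec, smul_zero])
  rw [smul_mul_assoc] at hs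
  exact map_mem_topLayer_of_mul_eq hϖ hc hcc (symplecticNilpotent_mul_self V) hs

omit hcov in
/-- The diagonal of the `p`-th power of a lift of `1 + A J`, for `p = 2` and `p = 3`. -/
theorem exists_mem_symplecticLayer_diag (hp23 : p = 2 ∨ p = 3) (hp : (p : R) = ϖ)
    (hsp : ∀ s, ρ s ∈ symplecticGroup l R) {s : H} {A Y : Matrix (l ⊕ l) (l ⊕ l) R}
    (hA : Aᵀ = A) (hAA : A * J l R * A = 0) (hs : ρ s = 1 + A * J l R + ϖ • Y) :
    ∃ x ∈ symplecticLayer hϖ ρ, ∀ b, x b b = π ((A + A * J l R * Y * A) b b) := by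
  have hNN : A * J l R * (A * J l R) = 0 := by rw [← mul_assoc, hAA, zero_mul]
  rcases hp23 with h | h
  -- Times J this is N + NY + YN for N = AJ. The symplectic condition on the lift, multiplied by AJ,
  -- replaces AJYJ by AYᵀ - AJYA, and AYᵀ has the same diagonal as YA.
  · refine ⟨(A - A * J l R * Y * J l R + Y * A).map π, ?_, fun b => ?_⟩
    · rw [mem_symplecticLayer, ← map_mul_J]
      convert map_mem_topLayer_of_two hϖ h hp hNN hs using 2
      rw [add_mul, sub_mul, mul_assoc _ (J l R) (J l R), J_mul_J]
      noncomm_ring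
    · have h0 := hsp s
      rw [hs] at h0
      have h1 := symplectic_lift_condition hϖ hA hAA h0
      have h2 : (A * J l R * (Y * J l R + Y * A + J l R * Yᵀ - A * Yᵀ)).map π = 0 := by
        rw [Matrix.map_mul, h1, mul_zero]
      have e : A * J l R * (Y * J l R + Y * A + J l R * Yᵀ - A * Yᵀ) =
          A * J l R * Y * J l R + A * J l R * Y * A - A * Yᵀ := by
        rw [mul_sub, ← mul_assoc _ A, hAA, mul_add, mul_add, ← mul_assoc _ (J l R),
          mul_assoc A (J l R) (J l R), J_mul_J]
        noncomm_ring
      have h3 : (A * Yᵀ) b b = (Y * A) b b := by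
        rw [← transpose_apply (A * Yᵀ), transpose_mul, transpose_transpose, hA]
      rw [e] at h2
      have h4 := congrFun (congrFun h2 b) b
      simp only [Matrix.map_apply, Matrix.add_apply, Matrix.sub_apply, map_add, map_sub,
        Matrix.zero_apply, h3] at h4 ⊢
      linear_combination -h4
  · refine ⟨(A + A * J l R * Y * A).map π, ?_, fun b => rfl⟩
    rw [mem_symplecticLayer, ← map_mul_J]
    convert map_mem_topLayer_of_three hϖ h hp hNN hs using 2
    noncomm_ring

/-- The two indices i ≠ j are used only for p = 2, to find a basis vector outside the hyperbolic
pair of b. -/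
theorem symm_mem_symplecticLayer_of_diag_ne_zero {i j : l} (hij : i ≠ j)
    (hsp : ∀ s, ρ s ∈ symplecticGroup l R) {b : l ⊕ l} {x : Matrix (l ⊕ l) (l ⊕ l) (ZMod p)}
    (hx : x ∈ symplecticLayer hϖ ρ) (hxb : x b b ≠ 0)
    {y : Matrix (l ⊕ l) (l ⊕ l) (ZMod p)} (hy : yᵀ = y) : y ∈ symplecticLayer hϖ ρ := by
  have hM : IsSymplecticStable (symplecticLayer hϖ ρ) := isSymplecticStable_symplecticLayer hcov
  by_cases hp : p = 2
  · subst hp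
    obtain ⟨c, hc1, hc2⟩ : ∃ c : l ⊕ l, c ≠ b.swap ∧ c ≠ b := by
      rcases b with k | k
      · by_cases hk : k = i
        · exact ⟨.inl j, by simp, by simp [hk, hij.symm]⟩
        · exact ⟨.inl i, by simp, by simp [Ne.symm hk]⟩
      · by_cases hk : k = i
        · exact ⟨.inr j, by simp, by simp [hk, hij.symm]⟩
        · exact ⟨.inr i, by simp, by simp [Ne.symm hk]⟩
    have hone : x b b = 1 := zmod_two_eq_one hxb
    exact hM.symm_mem_of_single (hM.exists_single_mem_of_two (b := b.swap) hc1 (by simpa using hc2)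
      hx (transpose_eq_of_mem_symplecticLayer hsp hx) (by simpa using hone)) hy
  · exact hM.symm_mem_of_single (hM.single_mem_of_odd hp (b := b.swap) hx (by simpa using hxb)) hy

/-- Otherwise every lift of 1 + u(B)J, for a symmetric block B, has B - B Y₂₁ B with zero diagonal
modulo p. For B = E_ii this gives (Y₂₁)_ii = 1, for B = E_ij + E_ji it gives (Z₂₁)_ii = 0, and for
their sum, lifted by the product, (Y₂₁ + Z₂₁)_ii = 0. -/
theorem symm_mem_symplecticLayer_of_two_or_three {i j : l} (hij : i ≠ j) (hp23 : p = 2 ∨ p = 3)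
    (hp : (p : R) = ϖ) (hsp : ∀ s, ρ s ∈ symplecticGroup l R)
    {y : Matrix (l ⊕ l) (l ⊕ l) (ZMod p)} (hy : yᵀ = y) : y ∈ symplecticLayer hϖ ρ := by
  by_contra hcon
  have hdiag : ∀ (s : H) (A Y : Matrix (l ⊕ l) (l ⊕ l) R), Aᵀ = A → A * J l R * A = 0 →
      ρ s = 1 + A * J l R + ϖ • Y → ∀ b, π ((A + A * J l R * Y * A) b b) = 0 := by
    intro s A Y hA hAA hs b
    obtain ⟨x, hx, hxd⟩ := exists_mem_symplecticLayer_diag (hϖ := hϖ) hp23 hp hsp hA hAA hs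
    by_contra hne
    rw [← hxd b] at hne
    exact hcon (symm_mem_symplecticLayer_of_diag_ne_zero hcov hij hsp hx hne hy)
  let u : Matrix l l R → Matrix (l ⊕ l) (l ⊕ l) R := fun B => fromBlocks B 0 0 0
  have hu : ∀ B, Bᵀ = B → (u B)ᵀ = u B := fun B hB => by
    simp only [u, fromBlocks_transpose, hB, transpose_zero]
  have huu : ∀ B C, u B * J l R * u C = 0 := fun B C => by
    simp [u, J, fromBlocks_multiply]
  have key : ∀ (s : H) (B : Matrix l l R) (Y : Matrix (l ⊕ l) (l ⊕ l) R), Bᵀ = B →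
      ρ s = 1 + u B * J l R + ϖ • Y →
      ∀ k, π ((B - B * Y.toBlocks₂₁ * B) k k) = 0 := by
    intro s B Y hB hs k
    have h := hdiag s (u B) Y (hu B hB) (huu B B) hs (.inl k)
    have e : u B + u B * J l R * Y * u B = u (B - B * Y.toBlocks₂₁ * B) := by
      conv_lhs => rw [← fromBlocks_toBlocks Y]
      simp [u, J, fromBlocks_multiply, fromBlocks_add, sub_eq_add_neg]
    rw [e] at h
    exact h
  have hB1 : (single i i (1 : R))ᵀ = single i i 1 := transpose_single _ _ _
  have hB3 : (single i j (1 : R) + single j i 1)ᵀ = single i j 1 + single j i 1 := by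
    rw [transpose_add, transpose_single, transpose_single, add_comm]
  obtain ⟨g, Y, hg⟩ := exists_symplectic_lift hcov (hu _ hB1) (huu _ _)
  obtain ⟨h, Z, hh⟩ := exists_symplectic_lift hcov (hu _ hB3) (huu _ _)
  have hgh := map_mul ρ g h
  rw [hg, hh, mul_lift_eq hϖ (by rw [← mul_assoc, huu, zero_mul]), ← add_mul] at hgh
  have huadd : u (single i i 1) + u (single i j 1 + single j i 1) =
      u (single i i 1 + (single i j 1 + single j i 1)) := by
    simp [u, fromBlocks_add]
  rw [huadd] at hgh
  have k1 := key _ _ _ hB1 hg i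
  have k2 := key _ _ _ hB3 hh j
  have k3 := key _ _ _ (by rw [transpose_add, hB1, hB3]) hgh j
  have e : (Y + Z + u (single i i 1) * J l R * Z +
      Y * (u (single i j 1 + single j i 1) * J l R)).toBlocks₂₁ =
      Y.toBlocks₂₁ + Z.toBlocks₂₁ := by
    conv_lhs => rw [← fromBlocks_toBlocks Y, ← fromBlocks_toBlocks Z]
    simp [u, J, fromBlocks_multiply, fromBlocks_add]
  rw [e] at k3
  simp [add_mul, mul_add, single_mul_mul_single, hij] at k1 k2 k3
  exact one_ne_zero (α := ZMod p) (by linear_combination k1 - k2 - k3)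

end TopLayerSp

/-! ### The ring ℤ/p^a as a top layer -/

section PrimePower

variable {p a : ℕ}

theorem isTopLayer_zmod_pow [Fact p.Prime] (ha : 2 ≤ a) :
    IsTopLayer (ZMod.castHom (dvd_pow_self p (by omega : a ≠ 0)) (ZMod p))
      ((p : ZMod (p ^ a)) ^ (a - 1)) where
  surjective := ZMod.castHom_surjective _
  mul_eq_zero_iff z := by
    have hp : 0 < p := (Fact.out : p.Prime).pos
    have : NeZero (p ^ a) := ⟨(pow_pos hp a).ne'⟩
    rw [← ZMod.natCast_zmod_val z, map_natCast, ← Nat.cast_pow, ← Nat.cast_mul,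
      ZMod.natCast_eq_zero_iff, ZMod.natCast_eq_zero_iff]
    generalize z.val = w
    rw [show p ^ a = p ^ (a - 1) * p by rw [← pow_succ]; congr 1; omega]
    exact Nat.mul_dvd_mul_iff_left (pow_pos hp _)
  map_self := by
    rw [map_pow, map_natCast, ZMod.natCast_self, zero_pow (by omega)]

theorem exists_eq_mul_of_castHom_eq_zero (hp : p.Prime) {z : ZMod (p ^ a)}
    (hz : ZMod.castHom (pow_dvd_pow p (Nat.sub_le a 1)) (ZMod (p ^ (a - 1))) z = 0) :
    ∃ w, z = (p : ZMod (p ^ a)) ^ (a - 1) * w := by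
  have : NeZero (p ^ a) := ⟨(pow_pos hp.pos a).ne'⟩
  rw [← ZMod.natCast_zmod_val z, map_natCast, ZMod.natCast_eq_zero_iff] at hz
  obtain ⟨w, hw⟩ := hz
  refine ⟨w, ?_⟩
  rw [← ZMod.natCast_zmod_val z, hw]
  push_cast
  rfl

theorem exists_eq_one_add_of_map_eq_one {m : Type*} [DecidableEq m] (hp : p.Prime)
    {k : Matrix m m (ZMod (p ^ a))}
    (hk : k.map (ZMod.castHom (pow_dvd_pow p (Nat.sub_le a 1)) (ZMod (p ^ (a - 1)))) = 1) :
    ∃ X : Matrix m m (ZMod (p ^ a)), k = 1 + (p : ZMod (p ^ a)) ^ (a - 1) • X := by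
  have h : ∀ i j, ∃ w, k i j - (1 : Matrix m m (ZMod (p ^ a))) i j =
      (p : ZMod (p ^ a)) ^ (a - 1) * w := fun i j => by
    refine exists_eq_mul_of_castHom_eq_zero hp ?_
    rw [map_sub, sub_eq_zero]
    have := congrFun (congrFun hk i) j
    rw [Matrix.map_apply] at this
    rw [this]
    by_cases hij : i = j
    · rw [hij, one_apply_eq, one_apply_eq, map_one]
    · rw [one_apply_ne hij, one_apply_ne hij, map_zero]
  choose X hX using h
  refine ⟨Matrix.of X, ?_⟩
  ext i j
  rw [Matrix.add_apply, Matrix.smul_apply, smul_eq_mul, Matrix.of_apply, ← hX]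
  ring

theorem pow_sub_two_mul (ha : 3 ≤ a) :
    (p : ZMod (p ^ a)) ^ (a - 2) * p = (p : ZMod (p ^ a)) ^ (a - 1) := by
  rw [← pow_succ]
  congr 1
  omega

/-- The exponent 2(a - 2) + 1 is at least a exactly from a = 3 on. -/
theorem pow_sub_two_mul_self (ha : 3 ≤ a) :
    (p : ZMod (p ^ a)) ^ (a - 2) * (p : ZMod (p ^ a)) ^ (a - 2) * p = 0 := by
  rw [← pow_add, ← pow_succ, ← Nat.cast_pow, ZMod.natCast_eq_zero_iff]
  exact pow_dvd_pow p (by omega)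

end PrimePower

/-! ### Supplements and the main theorem -/

theorem exists_mul_eq_of_supplement {G : Type*} [Group G] {N S : Subgroup G}
    (h : (N : Set G) * (S : Set G) = Set.univ) (g : G) : ∃ k ∈ N, ∃ s ∈ S, k * s = g := by
  have : g ∈ (N : Set G) * (S : Set G) := h ▸ Set.mem_univ g
  exact Set.mem_mul.1 this

theorem eq_top_of_supplement {G : Type*} [Group G] {N S : Subgroup G}
    (h : (N : Set G) * (S : Set G) = Set.univ) (hN : N ≤ S) : S = ⊤ := by
  rw [eq_top_iff]
  intro g _
  obtain ⟨k, hk, s, hs, rfl⟩ := exists_mul_eq_of_supplement h g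
  exact mul_mem (hN hk) hs

section Main

variable {p a n : ℕ}

/-- The matrices of the elements of a subgroup of `SL(n, R)`. -/
def specialLinearSubgroupHom {n : ℕ} {R : Type*} [CommRing R]
    (S : Subgroup (Matrix.SpecialLinearGroup (Fin n) R)) : S →* Matrix (Fin n) (Fin n) R where
  toFun s := (s : Matrix.SpecialLinearGroup (Fin n) R)
  map_one' := rfl
  map_mul' _ _ := rfl

theorem not_hasProperSupplement_kerSL [Fact p.Prime] (ha : 2 ≤ a)
    (hlarge : 3 ≤ a ∨ 5 ≤ p ∨ (p = 3 ∧ 3 ≤ n) ∨ (p = 2 ∧ 5 ≤ n)) :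
    ¬ HasProperSupplement (kerSL n (pow_dvd_pow p (Nat.sub_le a 1))) := by
  rintro ⟨S, hS, hKS⟩
  have hp : p.Prime := Fact.out
  have hϖ := isTopLayer_zmod_pow (p := p) ha
  have hker : ∀ k ∈ kerSL n (pow_dvd_pow p (Nat.sub_le a 1)),
      ∃ X : Matrix (Fin n) (Fin n) (ZMod (p ^ a)),
        (k : Matrix (Fin n) (Fin n) (ZMod (p ^ a))) = 1 + (p : ZMod (p ^ a)) ^ (a - 1) • X :=
    fun k hk => exists_eq_one_add_of_map_eq_one hp (congrArg Subtype.val hk)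
  have hcov : ∀ g : Matrix (Fin n) (Fin n) (ZMod (p ^ a)), g.det = 1 →
      ∃ s Y, specialLinearSubgroupHom S s = g + (p : ZMod (p ^ a)) ^ (a - 1) • Y := by
    intro g hg
    let g' : Matrix.SpecialLinearGroup (Fin n) (ZMod (p ^ a)) := ⟨g, hg⟩
    obtain ⟨k, hk, s, hs, hks⟩ := exists_mul_eq_of_supplement hKS g'
    obtain ⟨X, hX⟩ := hker _ (inv_mem hk)
    refine ⟨⟨s, hs⟩, X * g, ?_⟩
    have h1 : s = k⁻¹ * g' := by rw [← hks, inv_mul_cancel_left]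
    have h2 : (s : Matrix (Fin n) (Fin n) (ZMod (p ^ a))) = _ * g := congrArg Subtype.val h1
    change (s : Matrix (Fin n) (Fin n) (ZMod (p ^ a))) = _
    rw [h2, hX, add_mul, one_mul, smul_mul_assoc]
  have hpow : a = 2 → (p : ZMod (p ^ a)) = (p : ZMod (p ^ a)) ^ (a - 1) := by
    rintro rfl
    exact (pow_one _).symm
  have hall : ∀ i j, i ≠ j → single i j 1 ∈ topLayer hϖ (specialLinearSubgroupHom S) := by
    rcases Nat.lt_or_ge a 3 with ha3 | ha3
    · have ha2 : a = 2 := by omega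
      rcases hlarge with h | h | ⟨h, hn⟩ | ⟨h, hn⟩
      · omega
      · exact single_mem_topLayer_of_five_le hcov h (hpow ha2)
      · exact single_mem_topLayer_of_three hcov h (hpow ha2) (by simpa using hn)
      · exact single_mem_topLayer_of_two hcov h (hpow ha2) (Fin.castLEEmb hn)
    · exact single_mem_topLayer_of_mul_eq hcov (pow_sub_two_mul ha3) (pow_sub_two_mul_self ha3)
  refine hS (eq_top_of_supplement hKS fun k hk => ?_)
  obtain ⟨X, hX⟩ := hker k hk
  have htr : (X.map (ZMod.castHom (dvd_pow_self p (by omega : a ≠ 0)) (ZMod p))).trace = 0 := by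
    have h1 : (k : Matrix (Fin n) (Fin n) (ZMod (p ^ a))).det = 1 := k.2
    -- As ϖ² = 0, det(1 + ϖX) = 1 + ϖ tr X.
    rw [hX, det_one_add_smul, pow_two, hϖ.mul_self, mul_zero, add_zero, add_eq_left, mul_comm,
      hϖ.mul_eq_zero_iff] at h1
    rw [← h1]
    simp [trace]
  obtain ⟨s, hs⟩ := exists_of_mem_topLayer hϖ
    ((isTransvectionStable_topLayer hcov).mem_of_trace_eq_zero hall htr)
  have : (s : Matrix.SpecialLinearGroup (Fin n) (ZMod (p ^ a))) = k :=
    Subtype.ext (hs.trans hX.symm)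
  exact this ▸ s.2

theorem not_hasProperSupplement_kerSp [Fact p.Prime] (ha : 2 ≤ a) (hn : 2 ≤ n) :
    ¬ HasProperSupplement (kerSp n (pow_dvd_pow p (Nat.sub_le a 1))) := by
  rintro ⟨S, hS, hKS⟩
  have hp : p.Prime := Fact.out
  have hϖ := isTopLayer_zmod_pow (p := p) ha
  set ρ : S →* Matrix (Fin n ⊕ Fin n) (Fin n ⊕ Fin n) (ZMod (p ^ a)) :=
    (symplecticGroup (Fin n) (ZMod (p ^ a))).subtype.comp S.subtype with hρ
  have hsp : ∀ s, ρ s ∈ symplecticGroup (Fin n) (ZMod (p ^ a)) := fun s => s.1.2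
  have hker : ∀ k ∈ kerSp n (pow_dvd_pow p (Nat.sub_le a 1)),
      ∃ X : Matrix (Fin n ⊕ Fin n) (Fin n ⊕ Fin n) (ZMod (p ^ a)),
        k.1 = 1 + (p : ZMod (p ^ a)) ^ (a - 1) • X :=
    fun k hk => exists_eq_one_add_of_map_eq_one hp (congrArg Subtype.val hk)
  have hcov : ∀ g ∈ symplecticGroup (Fin n) (ZMod (p ^ a)),
      ∃ s Y, ρ s = g + (p : ZMod (p ^ a)) ^ (a - 1) • Y := by
    intro g hg
    let g' : symplecticGroup (Fin n) (ZMod (p ^ a)) := ⟨g, hg⟩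
    obtain ⟨k, hk, s, hs, hks⟩ := exists_mul_eq_of_supplement hKS g'
    obtain ⟨X, hX⟩ := hker _ (inv_mem hk)
    refine ⟨⟨s, hs⟩, X * g, ?_⟩
    have h1 : s = k⁻¹ * g' := by rw [← hks, inv_mul_cancel_left]
    have h2 : s.1 = k⁻¹.1 * g := congrArg Subtype.val h1
    change s.1 = _
    rw [h2, hX, add_mul, one_mul, smul_mul_assoc]
  have hpow : a = 2 → (p : ZMod (p ^ a)) = (p : ZMod (p ^ a)) ^ (a - 1) := by
    rintro rfl
    exact (pow_one _).symm
  have hall : ∀ x : Matrix (Fin n ⊕ Fin n) (Fin n ⊕ Fin n) (ZMod p), xᵀ = x →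
      x ∈ symplecticLayer hϖ ρ := by
    intro x hx
    rcases Nat.lt_or_ge a 3 with ha3 | ha3
    · have ha2 : a = 2 := by omega
      rcases Nat.lt_or_ge p 5 with h5 | h5
      · have h23 : p = 2 ∨ p = 3 := by
          have := hp.two_le
          interval_cases p
          · simp
          · simp
          · exact absurd hp (by decide)
        exact symm_mem_symplecticLayer_of_two_or_three hcov
          (i := ⟨0, by omega⟩) (j := ⟨1, by omega⟩) (by simp) h23 (hpow ha2) hsp hx
      · exact symm_mem_symplecticLayer_of_five_le hcov h5 (hpow ha2) hx
    · exact symm_mem_symplecticLayer_of_mul_eq hcov (pow_sub_two_mul ha3)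
        (pow_sub_two_mul_self ha3) hx
  refine hS (eq_top_of_supplement hKS fun k hk => ?_)
  obtain ⟨X, hX⟩ := hker k hk
  have hmem : X.map (ZMod.castHom (dvd_pow_self p (by omega : a ≠ 0)) (ZMod p)) ∈
      topLayer hϖ ρ := by
    set π := ZMod.castHom (dvd_pow_self p (by omega : a ≠ 0)) (ZMod p) with hπ
    have h0 := k.2
    rw [hX] at h0
    have h1 := symplectic_lift_condition hϖ (A := 0) (Y := X) (by simp) (by simp) (by simpa using h0)
    -- The symmetric matrix attached to X is x = -XJ, because J² = -1 gives xJ = X.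
    have hsym : (-(X * J (Fin n) (ZMod (p ^ a))).map π)ᵀ = -(X * J (Fin n) (ZMod (p ^ a))).map π := by
      ext i j
      have := congrFun (congrFun h1 i) j
      have h2 : (J (Fin n) (ZMod (p ^ a)) * Xᵀ) i j = -(X * J (Fin n) (ZMod (p ^ a))) j i := by
        rw [← transpose_apply (X * J (Fin n) (ZMod (p ^ a))), transpose_mul, J_transpose]
        simp
      simp only [mul_zero, zero_mul, add_zero, sub_zero, Matrix.map_apply, Matrix.add_apply,
        map_add, Matrix.zero_apply, h2, map_neg] at this
      simp only [transpose_apply, Matrix.neg_apply, Matrix.map_apply]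
      linear_combination this
    have h3 := hall _ hsym
    rw [mem_symplecticLayer, map_mul_J, neg_mul, mul_assoc, J_mul_J] at h3
    simpa using h3
  obtain ⟨s, hs⟩ := exists_of_mem_topLayer hϖ hmem
  have : s.1 = k := Subtype.ext (hs.trans hX.symm)
  exact this ▸ s.2

end Main

theorem theorem2p4 (p : ℕ) (hp : p.Prime) (a n : ℕ) (ha : 2 ≤ a) (hn : 2 ≤ n) :
    (HasProperSupplement (kerSL n (pow_dvd_pow p (Nat.sub_le a 1))) ↔
      (n = 2 ∧ p ^ a = 4) ∨ (n = 2 ∧ p ^ a = 9) ∨ (n = 3 ∧ p ^ a = 4) ∨ (n = 4 ∧ p ^ a = 4)) ∧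
    ¬ HasProperSupplement (kerSp n (pow_dvd_pow p (Nat.sub_le a 1))) := by
  have : Fact p.Prime := ⟨hp⟩
  refine ⟨⟨fun h => ?_, fun h => ?_⟩, not_hasProperSupplement_kerSp ha hn⟩
  · by_contra hcon
    refine not_hasProperSupplement_kerSL ha ?_ h
    by_contra hlarge
    simp only [not_or, not_and, not_le] at hlarge
    obtain ⟨h3, h5, h33, h25⟩ := hlarge
    -- What is left is p = 2 with n ≤ 4 and p = 3 with n = 2, which are the four listed groups.
    obtain rfl : a = 2 := by omega
    have h2 := hp.two_le
    interval_cases p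
    · have := h25 rfl
      omega
    · have := h33 rfl
      omega
    · exact absurd hp (by decide)
  · have hsq : ∀ q : ℕ, q.Prime → p ^ a = q ^ 2 → p = q ∧ a = 2 := by
      intro q hq hpq
      obtain rfl : p = q := (Nat.prime_dvd_prime_iff_eq hp hq).1
        (hp.dvd_of_dvd_pow (hpq ▸ dvd_pow_self p (by omega)))
      exact ⟨rfl, Nat.pow_right_injective hp.two_le hpq⟩
    rcases h with ⟨rfl, h⟩ | ⟨rfl, h⟩ | ⟨rfl, h⟩ | ⟨rfl, h⟩
    · obtain ⟨rfl, rfl⟩ := hsq 2 Nat.prime_two h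
      exact hasProperSupplement_SL_two_four _
    · obtain ⟨rfl, rfl⟩ := hsq 3 Nat.prime_three h
      exact hasProperSupplement_SL_two_nine _
    · obtain ⟨rfl, rfl⟩ := hsq 2 Nat.prime_two h
      exact hasProperSupplement_SL_three_four _
    · obtain ⟨rfl, rfl⟩ := hsq 2 Nat.prime_two h
      exact hasProperSupplement_SL_four_four _
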